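/- Let $m\ge 1$ and let $\mathbb{R}_m$ be the real Clifford algebra generated by $e_1,\dots,e_m$ with $e_ie_j+e_je_i=-2\delta_{ij}$, with the norm $|\sum_A x_Ae_A|=(\sum_A x_A^2)^{1/2}$ in the basis of products $e_A=e_{i_1}\cdots e_{i_k}$, $A=\{i_1<\dots<i_k\}$. A point $x=(x_0,\dots,x_m)\in\mathbb{R}^{m+1}$ is identified with the paravector $x_0+\underline{x}$, $\underline{x}=\sum_{j=1}^m x_je_j$; put $\overline{x}=x_0-\underline{x}$. The real axis is $\mathbb{R}=\{\underline{x}=0\}$. Let $\mathbb{S}$ be the unit sphere $\{\underline{x}:|\underline{x}|=1\}$ and $\omega_{m-1}$ its surface area ($\omega_0=2$). For $D\subset\mathbb{C}$ open put $\Omega_D=\{u+Jv: u+iv\in D,\ J\in\mathbb{S}\}\subset\mathbb{R}^{m+1}$; an open set of this form is called axially symmetric. Let $$S^{-1}(q,x)=-(q^2-2x_0q+|x|^2)^{-1}(q-\overline{x}),\qquad K(q,x)=\frac{2\,S^{-1}(q,x)}{\omega_{m-1}|\underline{x}|^{m-1}},$$ $$T_{\Omega_D}f(q)=-\frac1{2\pi}\int_{\Omega_D}K(q,x)f(x)\,dV(x),\qquad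 G=\frac{\partial}{\partial x_0}+\frac{\underline{x}}{|\underline{x}|^2}\sum_{j=1}^m x_j\frac{\partial}{\partial x_j}.$$ Let $\Omega_D\subset\mathbb{R}^{m+1}\setminus\mathbb{R}$ be a bounded axially symmetric open set (not necessarily connected) and let $\max\{m,2\}<p<\infty$. Then: 1. For every $f\in L^p(\Omega_D;\mathbb{R}_m)$ the integral defining $T_{\Omega_D}f(q)$ exists (converges absolutely) for every $q\in\mathbb{R}^{m+1}$ that is not a real boundary point of $\Omega_D$, i.e. for every $q\in\mathbb{R}^{m+1}\setminus(\partial\Omega_D\cap\mathbb{R})$, in particular for every $q\in\mathbb{R}^{m+1}\setminus\mathbb{R}$; if moreover $p>m+1$ (which is automatic when $m=1$), it exists for every $q\in\mathbb{R}^{m+1}$. 2. For every such $f$, the function $T_{\Omega_D}f$ is differentiable and satisfies $G\,T_{\Omega_D}f=0$ at every point of $(\mathbb{R}^{m+1}\setminus\mathbb{R})\setminus\overline{\Omega_D}$. 3. There is a constant $C$, independent of $f$, such that for every $f\in L^p(\Omega_D;\mathbb{R}_m)$ one has $T_{\Omega_D}f\in L^p(\Omega_D;\mathbb{R}_m)$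 and $\|T_{\Omega_D}f\|_{L^p(\Omega_D)}\le C\,\|f\|_{L^p(\Omega_D)}$. -/

import Mathlib

open MeasureTheory
open scoped ENNReal NNReal

namespace SliceClifford

noncomputable section

/-! ### The real Clifford algebra with `e i * e j + e j * e i = -2 δ i j`, and its norm -/

/-- The quadratic form `x ↦ -(x₁² + ⋯ + x_m²)` on `ℝ^m`. -/
abbrev negSumSq (m : ℕ) : QuadraticForm ℝ (Fin m → ℝ) :=
  QuadraticMap.weightedSumSquares ℝ (fun _ : Fin m => (-1 : ℝ))

/-- The real Clifford algebra on `m` generators of square `-1`. -/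
abbrev Cl (m : ℕ) : Type := CliffordAlgebra (negSumSq m)

/-- The generators `e 1, …, e m` of the Clifford algebra. -/
def e {m : ℕ} (i : Fin m) : Cl m := CliffordAlgebra.ι (negSumSq m) (Pi.single i 1)

/-- For `A = {i₁ < ⋯ < i_k}`, the product `e i₁ * ⋯ * e i_k`. -/
def blade {m : ℕ} (A : Finset (Fin m)) : Cl m := ((A.sort (· ≤ ·)).map e).prod

theorem negSumSq_apply {m : ℕ} (v : Fin m → ℝ) : negSumSq m v = -∑ i, v i ^ 2 := by
  simp [negSumSq, QuadraticMap.weightedSumSquares_apply, sq]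

theorem e_mul_self {m : ℕ} (i : Fin m) : e i * e i = (-1 : Cl m) := by
  rw [e, CliffordAlgebra.ι_sq_scalar, negSumSq_apply, Finset.sum_eq_single i]
  · simp
  · intro j _ hj
    simp [hj]
  · simp

theorem polar_single {m : ℕ} {i j : Fin m} (h : i ≠ j) :
    QuadraticMap.polar (negSumSq m) (Pi.single i 1) (Pi.single j 1) = 0 := by
  simp only [QuadraticMap.polar, negSumSq_apply]
  have : ∀ k : Fin m, ((Pi.single i (1 : ℝ) + Pi.single j 1 : Fin m → ℝ) k) ^ 2 =
      (Pi.single i (1 : ℝ) : Fin m → ℝ) k ^ 2 + (Pi.single j (1 : ℝ) : Fin m → ℝ) k ^ 2 := by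
    intro k
    rcases eq_or_ne k i with rfl | hk
    · simp [Pi.single_eq_of_ne h]
    · simp [Pi.single_eq_of_ne hk]
  simp_rw [this, Finset.sum_add_distrib]
  ring

theorem e_mul_e_add_swap {m : ℕ} {i j : Fin m} (h : i ≠ j) :
    e i * e j + e j * e i = (0 : Cl m) := by
  rw [e, e, CliffordAlgebra.ι_mul_ι_add_swap, polar_single h, map_zero]

/-- The basis of the Clifford algebra indexed by the subsets of `{1, …, m}`; its members are the
products `blade A`, see `cliffordBasis_apply`. -/
def cliffordBasis (m : ℕ) : Module.Basis (Finset (Fin m)) ℝ (Cl m) :=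
  ((Pi.basisFun ℝ (Fin m)).ExteriorAlgebra).map
    (CliffordAlgebra.equivExterior (negSumSq m)).symm

theorem contractLeft_list_prod {V : Type*} [AddCommGroup V] [Module ℝ V]
    (Q : QuadraticForm ℝ V) (d : Module.Dual ℝ V) (l : List V) (h : ∀ v ∈ l, d v = 0) :
    CliffordAlgebra.contractLeft d ((l.map (CliffordAlgebra.ι Q)).prod) = 0 := by
  induction l with
  | nil => simp
  | cons a l ih =>
    rw [List.map_cons, List.prod_cons, CliffordAlgebra.contractLeft_ι_mul,
      ih (fun v hv => h v (List.mem_cons_of_mem _ hv)), h a (by simp)]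
    simp

theorem changeForm_list_prod {V : Type*} [AddCommGroup V] [Module ℝ V]
    {Q Q' : QuadraticForm ℝ V} {B : LinearMap.BilinForm ℝ V}
    (hB : LinearMap.BilinMap.toQuadraticMap B = Q' - Q) (l : List V)
    (h : l.Pairwise (fun v w => B v w = 0)) :
    CliffordAlgebra.changeForm hB ((l.map (CliffordAlgebra.ι Q)).prod) =
      (l.map (CliffordAlgebra.ι Q')).prod := by
  induction l with
  | nil => simp
  | cons a l ih =>
    rw [List.pairwise_cons] at h
    rw [List.map_cons, List.prod_cons, CliffordAlgebra.changeForm_ι_mul, ih h.2,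
      contractLeft_list_prod _ _ _ h.1, sub_zero, List.map_cons, List.prod_cons]

theorem cliffordBasis_apply {m : ℕ} (A : Finset (Fin m)) : cliffordBasis m A = blade A := by
  rw [cliffordBasis, Module.Basis.map_apply, LinearEquiv.symm_apply_eq,
    ExteriorAlgebra.basis_apply_ofCard (n := A.card) (Pi.basisFun ℝ (Fin m)) rfl,
    ExteriorAlgebra.ιMulti_family, ExteriorAlgebra.ιMulti_apply]
  have key : (blade A : Cl m) =
      (((A.sort (· ≤ ·)).map (fun i => (Pi.single i 1 : Fin m → ℝ))).map
        (CliffordAlgebra.ι (negSumSq m))).prod := by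
    rw [blade, List.map_map]; rfl
  rw [key, CliffordAlgebra.equivExterior, CliffordAlgebra.changeFormEquiv_apply,
    changeForm_list_prod]
  · rw [List.ofFn_eq_map, ← Finset.listMap_orderEmbOfFin_finRange A rfl]
    simp only [List.map_map]
    congr 1
    apply List.map_congr_left
    intro i _
    simp only [Function.comp_apply, Pi.basisFun_apply]
    rfl
  · rw [List.pairwise_map]
    refine (A.sort_nodup (· ≤ ·)).imp ?_
    intro i j hij
    have h2 := polar_single (m := m) hij
    rw [QuadraticMap.polar] at h2
    rw [QuadraticMap.associated_apply]
    simp only [neg_apply]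
    rw [show -(negSumSq m) (Pi.single i 1 + Pi.single j 1) - -(negSumSq m) (Pi.single i 1)
      - -(negSumSq m) (Pi.single j 1) = 0 by linarith]
    simp

/-- Coordinates with respect to the basis `blade A`, as a vector of Euclidean space. -/
def coords (m : ℕ) : Cl m ≃ₗ[ℝ] EuclideanSpace ℝ (Finset (Fin m)) :=
  (cliffordBasis m).equivFun.trans (WithLp.linearEquiv 2 ℝ (Finset (Fin m) → ℝ)).symm

/-- The norm `|∑ x_A e_A| = (∑ x_A²)^{1/2}`. -/
instance instNormedAddCommGroupCl (m : ℕ) : NormedAddCommGroup (Cl m) :=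
  NormedAddCommGroup.induced (Cl m) (EuclideanSpace ℝ (Finset (Fin m))) (coords m)
    (coords m).injective

theorem norm_eq_sqrt {m : ℕ} (x : Cl m) :
    ‖x‖ = Real.sqrt (∑ A, ((cliffordBasis m).repr x A) ^ 2) := by
  change ‖coords m x‖ = _
  rw [EuclideanSpace.norm_eq]
  simp [coords]

instance instNormedSpaceCl (m : ℕ) : NormedSpace ℝ (Cl m) :=
  NormedSpace.induced ℝ (Cl m) (EuclideanSpace ℝ (Finset (Fin m))) (coords m)

instance instFiniteDimensionalCl (m : ℕ) : FiniteDimensional ℝ (Cl m) :=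
  (cliffordBasis m).finiteDimensional_of_finite

instance instCompleteSpaceCl (m : ℕ) : CompleteSpace (Cl m) :=
  FiniteDimensional.complete ℝ (Cl m)

/-! ### Paravectors: points `x = (x₀, x₁, …, x_m)` of `ℝ^{m+1}` -/

/-- `ℝ^{m+1}` with the Euclidean norm. -/
abbrev Para (m : ℕ) : Type := EuclideanSpace ℝ (Fin (m + 1))

/-- The `1`-vector part `x₁ e₁ + ⋯ + x_m e_m` of a paravector. -/
def vec {m : ℕ} (x : Para m) : Cl m := ∑ j : Fin m, x j.succ • e j

/-- The length `(x₁² + ⋯ + x_m²)^{1/2}` of the `1`-vector part. -/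
def vecNorm {m : ℕ} (x : Para m) : ℝ := Real.sqrt (∑ j : Fin m, x j.succ ^ 2)

/-- The paravector `x₀ + x₁ e₁ + ⋯ + x_m e_m` as an element of the Clifford algebra. -/
def toCl {m : ℕ} (x : Para m) : Cl m := algebraMap ℝ (Cl m) (x 0) + vec x

/-- The Clifford conjugate `x₀ - (x₁ e₁ + ⋯ + x_m e_m)` of a paravector. -/
def conjCl {m : ℕ} (x : Para m) : Cl m := algebraMap ℝ (Cl m) (x 0) - vec x

/-- The real axis of `ℝ^{m+1}`. -/
def realAxis (m : ℕ) : Set (Para m) := {x | ∀ j : Fin m, x j.succ = 0}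

/-- For `z = u + iv` and a unit vector `J` of `ℝ^m`, the point `u + J v` of `ℝ^{m+1}`. -/
def slicePoint {m : ℕ} (J : EuclideanSpace ℝ (Fin m)) (z : ℂ) : Para m :=
  WithLp.toLp 2 (Fin.cons z.re (fun j => J j * z.im))

/-- The set swept out by the copies `{u + J v : u + iv ∈ D}` of `D` as `J` runs over the unit
sphere of `ℝ^m`. -/
def axialSet (m : ℕ) (D : Set ℂ) : Set (Para m) :=
  ⋃ J ∈ Metric.sphere (0 : EuclideanSpace ℝ (Fin m)) 1, slicePoint J '' D

/-- Axially symmetric open sets. -/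
def IsAxiallySymmetric {m : ℕ} (Ω : Set (Para m)) : Prop :=
  IsOpen Ω ∧ ∃ D : Set ℂ, IsOpen D ∧ Ω = axialSet m D

/-! ### The kernel, the Teodorescu transform and the slice Cauchy-Riemann operator -/

/-- The slice Cauchy kernel `-(q² - 2 x₀ q + |x|²)⁻¹ (q - x̄)`. The inverse is the one of the
Clifford algebra; it is replaced by `0` where it does not exist, which for fixed `q` concerns only
the points `x` with `x₀ = q₀` and `vecNorm x = vecNorm q`. -/
def sliceCauchyKernel {m : ℕ} (q x : Para m) : Cl m :=
  -(Ring.inverse (toCl q ^ 2 - (2 * x 0) • toCl q + algebraMap ℝ (Cl m) (‖x‖ ^ 2)) *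
    (toCl q - conjCl x))

/-- The surface area of the unit sphere of `ℝ^m` (equal to `2` for `m = 1`). -/
def sphereArea (m : ℕ) : ℝ :=
  (volume : Measure (EuclideanSpace ℝ (Fin m))).toSphere.real Set.univ

/-- The kernel `K(q, x) = 2 S⁻¹(q, x) / (ω |x̲|^{m-1})`, where `ω` is the area of the unit sphere of
`ℝ^m`. The exponent `m - 1` is a natural number since the kernel is used for `1 ≤ m` only. -/
def kernelK {m : ℕ} (q x : Para m) : Cl m :=
  (2 / (sphereArea m * vecNorm x ^ (m - 1))) • sliceCauchyKernel q x

/-- The Teodorescu transform `T f (q) = -(1/2π) ∫_Ω K(q, x) f(x) dV(x)`. -/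
def teodorescu {m : ℕ} (Ω : Set (Para m)) (f : Para m → Cl m) (q : Para m) : Cl m :=
  -((1 / (2 * Real.pi)) • ∫ x in Ω, kernelK q x * f x)

/-- The slice Cauchy-Riemann operator `G = ∂/∂x₀ + (x̲ / |x̲|²) ∑ⱼ xⱼ ∂/∂xⱼ`, used off the real
axis. -/
def sliceCR {m : ℕ} (f : Para m → Cl m) (x : Para m) : Cl m :=
  lineDeriv ℝ f x (EuclideanSpace.single 0 1) +
    ((vecNorm x ^ 2)⁻¹ • vec x) *
      ∑ j : Fin m, x j.succ • lineDeriv ℝ f x (EuclideanSpace.single j.succ 1)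

end

end SliceClifford

/-!
The kernel depends on `x` essentially through the point `z_x = x₀ + i |x̲|` of the closed upper
half plane: `q² - 2 x₀ q + |x|²` is a paravector of norm `|z_q - z_x| |z̄_q - z_x|`, and `q - x̄` is
one of norm at most `|z̄_q - z_x|`, so that `|S⁻¹(q, x)| ≤ C |z_q - z_x|⁻¹`. In cylindrical
coordinates the volume element cancels a factor `|x̲|^{m-1}` of the singularity of `|K(q, x)|^P`,
`1/p + 1/P = 1`. What is left at `|x̲| = 0` merges with the singularity at `|x̲| = |q̲|` as
`|q̲| → 0`, and the norm of `K(q, ·)` in `L^P` is at most `C |q̲|^{-(m-1)/p}`; it is bounded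
uniformly in `q` if `p > m + 1`. Hölder's inequality gives the integrability and
`|T f(q)| ≤ C |q̲|^{-(m-1)/p} ‖f‖_p`, whose `p`-th power is locally integrable in `q` because
`m - 1 < m`.

Away from the closure one differentiates under the integral sign. Differentiating
`(q² - 2 x₀ q + |x|²) S⁻¹(q, x) = -(q - x̄)` shows that the derivative of `S⁻¹(·, x)` in the
direction `q̲` is `q̲` times the one in the direction `1`; as `q̲² = -|q̲|²`, this says
`G S⁻¹(·, x) = 0`.
-/

namespace SliceClifford

theorem ennreal_rpow_neg_add (x : ℝ≥0∞) {a b : ℝ} (ha : 0 ≤ a) (hb : 0 ≤ b) :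
    x ^ (-(a + b)) = x ^ (-a) * x ^ (-b) := by
  rw [ENNReal.rpow_neg, ENNReal.rpow_neg, ENNReal.rpow_neg, ENNReal.rpow_add_of_nonneg _ _ ha hb]
  rcases eq_or_ne x ∞ with rfl | hx
  · rcases ha.eq_or_lt with rfl | ha
    · simp
    rcases hb.eq_or_lt with rfl | hb
    · simp
    simp [ha, hb]
  · exact ENNReal.mul_inv (.inr (ENNReal.rpow_ne_top_of_nonneg hb hx))
      (.inl (ENNReal.rpow_ne_top_of_nonneg ha hx))

theorem ennreal_rpow_neg_le_rpow_neg {x y : ℝ≥0∞} {a : ℝ} (h : x ≤ y) (ha : 0 ≤ a) :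
    y ^ (-a) ≤ x ^ (-a) := by
  rw [ENNReal.rpow_neg, ENNReal.rpow_neg]
  gcongr

/-- Of two small quantities whose sum is at least `r`, only one can be much smaller than `r`. -/
theorem ennreal_rpow_neg_mul_rpow_neg_le {θ a s : ℝ} (hθ : 0 ≤ θ) (hθa : θ ≤ a) (hθs : θ ≤ s)
    {x y r : ℝ≥0∞} (h : r ≤ x + y) :
    x ^ (-a) * y ^ (-s) ≤ (r / 2) ^ (-θ) * (x ^ (-(a + s - θ)) + y ^ (-(a + s - θ))) := by
  wlog hxy : x ≤ y generalizing x y a s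
  · have := this hθs hθa (add_comm x y ▸ h) (le_of_not_ge hxy)
    rwa [mul_comm, add_comm (y ^ _), add_comm s] at this
  have hry : r / 2 ≤ y := ENNReal.div_le_of_le_mul <| by
    rw [mul_two]
    exact h.trans (by gcongr)
  calc x ^ (-a) * y ^ (-s) = x ^ (-a) * (y ^ (-θ) * y ^ (-(s - θ))) := by
        rw [← ennreal_rpow_neg_add y hθ (sub_nonneg.2 hθs), add_sub_cancel]
    _ ≤ x ^ (-a) * ((r / 2) ^ (-θ) * x ^ (-(s - θ))) := by
        gcongr x ^ (-a) * (?_ * ?_)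
        · exact ennreal_rpow_neg_le_rpow_neg hry hθ
        · exact ennreal_rpow_neg_le_rpow_neg hxy (sub_nonneg.2 hθs)
    _ = (r / 2) ^ (-θ) * x ^ (-(a + s - θ)) := by
        rw [add_sub_assoc, ennreal_rpow_neg_add x (hθ.trans hθa) (sub_nonneg.2 hθs)]
        ring
    _ ≤ _ := by
        gcongr
        exact le_self_add

section RadialIntegral

variable {E : Type*} [NormedAddCommGroup E] [NormedSpace ℝ E] [MeasurableSpace E] [BorelSpace E]
  [FiniteDimensional ℝ E] (μ : Measure E) [μ.IsAddHaarMeasure]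

theorem lintegral_fun_norm_addHaar [Nontrivial E] {f : ℝ → ℝ≥0∞} (hf : Measurable f) :
    ∫⁻ x, f ‖x‖ ∂μ = μ.toSphere Set.univ *
      ∫⁻ y in Set.Ioi (0 : ℝ), ENNReal.ofReal (y ^ (Module.finrank ℝ E - 1)) * f y := by
  have hcompl : ∫⁻ x, f ‖x‖ ∂μ = ∫⁻ x : ({0}ᶜ : Set E), f ‖(x : E)‖ ∂μ.comap (↑) := by
    rw [lintegral_subtype_comap (measurableSet_singleton (0 : E)).compl fun x => f ‖x‖,
      restrict_compl_singleton]
  have hpolar : ∫⁻ x : ({0}ᶜ : Set E), f ‖(x : E)‖ ∂μ.comap (↑) =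
      ∫⁻ z, f z.2 ∂μ.toSphere.prod (.volumeIoiPow (Module.finrank ℝ E - 1)) := by
    simpa only [homeomorphUnitSphereProd_apply_snd_coe] using
      μ.measurePreserving_homeomorphUnitSphereProd.lintegral_comp (f := fun z => f z.2)
        (by fun_prop)
  have hradial : ∫⁻ r : Set.Ioi (0 : ℝ), f r ∂.volumeIoiPow (Module.finrank ℝ E - 1) =
      ∫⁻ y in Set.Ioi (0 : ℝ), ENNReal.ofReal (y ^ (Module.finrank ℝ E - 1)) * f y := by
    rw [Measure.volumeIoiPow,
      lintegral_withDensity_eq_lintegral_mul _ (by fun_prop) (by fun_prop)]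
    exact lintegral_subtype_comap measurableSet_Ioi
      fun y => ENNReal.ofReal (y ^ (Module.finrank ℝ E - 1)) * f y
  rw [← hradial, hcompl, hpolar, lintegral_prod _ (by fun_prop)]
  simp only [lintegral_const, mul_comm]

theorem setLIntegral_ball_fun_norm [Nontrivial E] {f : ℝ → ℝ≥0∞} (hf : Measurable f) (R : ℝ) :
    ∫⁻ x in Metric.ball 0 R, f ‖x‖ ∂μ = μ.toSphere Set.univ *
      ∫⁻ y in Set.Ioo 0 R, ENNReal.ofReal (y ^ (Module.finrank ℝ E - 1)) * f y := by
  have hball : ∀ x : E, (Metric.ball 0 R).indicator (fun x => f ‖x‖) x =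
      (Set.Iio R).indicator f ‖x‖ := fun x => by simp [Set.indicator]
  rw [← lintegral_indicator measurableSet_ball, lintegral_congr hball,
    lintegral_fun_norm_addHaar μ (hf.indicator measurableSet_Iio), ← Set.Ioi_inter_Iio,
    Set.inter_comm, ← setLIntegral_indicator measurableSet_Iio]
  simp only [Set.indicator_mul_right]

theorem setLIntegral_ball_enorm_rpow_neg_lt_top [Nontrivial E] {s : ℝ}
    (hs : s < Module.finrank ℝ E) (R : ℝ) :
    ∫⁻ x in Metric.ball 0 R, ‖x‖ₑ ^ (-s) ∂μ < ∞ := by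
  have hint : IntegrableOn (fun x : E => ‖x‖ ^ (-s)) (Metric.ball 0 R) μ :=
    integrableOn_ball_of_norm_le_rpow (C := 1) Module.finrank_pos hs
      (.of_forall fun x => by rw [one_mul, Real.norm_of_nonneg (by positivity)])
      (by fun_prop : Measurable fun x : E => ‖x‖ ^ (-s)).aestronglyMeasurable
  refine (lintegral_congr_ae ?_).trans_lt hint.hasFiniteIntegral
  filter_upwards [ae_restrict_of_ae (Measure.ae_ne μ 0)] with x hx
  rw [Real.enorm_eq_ofReal (by positivity), ← ENNReal.ofReal_rpow_of_pos (norm_pos_iff.2 hx),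
    ofReal_norm]

/-- Near `c` the integral is at most the one over the unit ball, away from `c` the integrand is at
most `1`. -/
theorem exists_setLIntegral_ball_enorm_sub_rpow_neg_le [Nontrivial E] {s : ℝ} (hs₀ : 0 ≤ s)
    (hs : s < Module.finrank ℝ E) (R : ℝ) :
    ∃ C ≠ ∞, ∀ c : E, ∫⁻ x in Metric.ball 0 R, ‖x - c‖ₑ ^ (-s) ∂μ ≤ C := by
  have hpoint : ∀ x : E, ‖x‖ₑ ^ (-s) ≤
      (Metric.ball 0 1).indicator (fun y => ‖y‖ₑ ^ (-s)) x + 1 := by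
    intro x
    by_cases hx : x ∈ Metric.ball 0 1
    · rw [Set.indicator_of_mem hx]
      exact le_self_add
    · have h1 : 1 ≤ ‖x‖ₑ := by
        rw [← ofReal_norm, ENNReal.one_le_ofReal]
        simpa using hx
      rw [Set.indicator_of_notMem hx, zero_add]
      simpa using ennreal_rpow_neg_le_rpow_neg h1 hs₀
  refine ⟨∫⁻ x in Metric.ball 0 1, ‖x‖ₑ ^ (-s) ∂μ + μ (Metric.ball 0 R),
    ENNReal.add_ne_top.2 ⟨(setLIntegral_ball_enorm_rpow_neg_lt_top μ hs 1).ne,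
      measure_ball_lt_top.ne⟩, fun c => ?_⟩
  calc ∫⁻ x in Metric.ball 0 R, ‖x - c‖ₑ ^ (-s) ∂μ
      ≤ ∫⁻ x in Metric.ball 0 R,
          ((Metric.ball 0 1).indicator (fun y => ‖y‖ₑ ^ (-s)) (x - c) + 1) ∂μ :=
        lintegral_mono fun x => hpoint (x - c)
    _ = ∫⁻ x in Metric.ball 0 R, (Metric.ball 0 1).indicator (fun y => ‖y‖ₑ ^ (-s)) (x - c) ∂μ +
          μ (Metric.ball 0 R) := by
        rw [lintegral_add_right _ measurable_const, setLIntegral_one]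
    _ ≤ ∫⁻ x, (Metric.ball 0 1).indicator (fun y => ‖y‖ₑ ^ (-s)) (x - c) ∂μ +
          μ (Metric.ball 0 R) := by
        gcongr
        exact Measure.restrict_le_self
    _ = _ := by
        rw [lintegral_sub_right_eq_self
          (fun y => (Metric.ball 0 1).indicator (fun y => ‖y‖ₑ ^ (-s)) y) c,
          lintegral_indicator measurableSet_ball]

end RadialIntegral

/-- The singularities of the integrand at `0` and at `r` merge as `r → 0`; the factor `|r|^{-θ}`
accounts for the part of the total exponent that is then no longer integrable. -/
theorem exists_setLIntegral_Ioo_rpow_neg_mul_le {θ a s : ℝ} (hθ : 0 ≤ θ) (hθa : θ ≤ a)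
    (hθs : θ ≤ s) (has : a + s - θ < 1) (R : ℝ) :
    ∃ C ≠ ∞, ∀ r : ℝ, ∫⁻ v in Set.Ioo 0 R, ‖v‖ₑ ^ (-a) * ‖v - r‖ₑ ^ (-s) ≤
      C * ‖r‖ₑ ^ (-θ) := by
  obtain ⟨C, hC, hle⟩ := exists_setLIntegral_ball_enorm_sub_rpow_neg_le (volume : Measure ℝ)
    (s := a + s - θ) (by linarith) (by simpa using has) R
  refine ⟨2 ^ θ * (C + C), by finiteness, fun r => ?_⟩
  have hsub : Set.Ioo 0 R ⊆ Metric.ball 0 R := fun v hv => by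
    rw [mem_ball_zero_iff, Real.norm_of_nonneg hv.1.le]
    exact hv.2
  have hr : ∀ v : ℝ, ‖r‖ₑ ≤ ‖v‖ₑ + ‖v - r‖ₑ := fun v => by
    simpa using enorm_sub_le (a := v) (b := v - r)
  calc ∫⁻ v in Set.Ioo 0 R, ‖v‖ₑ ^ (-a) * ‖v - r‖ₑ ^ (-s)
      ≤ ∫⁻ v in Metric.ball 0 R, (‖r‖ₑ / 2) ^ (-θ) *
          (‖v - 0‖ₑ ^ (-(a + s - θ)) + ‖v - r‖ₑ ^ (-(a + s - θ))) := by
        refine (lintegral_mono fun v => ?_).trans (lintegral_mono_set hsub)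
        rw [sub_zero]
        exact ennreal_rpow_neg_mul_rpow_neg_le hθ hθa hθs (hr v)
    _ ≤ (‖r‖ₑ / 2) ^ (-θ) * (C + C) := by
        rw [lintegral_const_mul _ (by fun_prop), lintegral_add_left (by fun_prop)]
        gcongr
        exacts [hle 0, hle r]
    _ = 2 ^ θ * (C + C) * ‖r‖ₑ ^ (-θ) := by
        rw [div_eq_mul_inv, ENNReal.mul_rpow_of_ne_top (by simp) (by simp), ENNReal.inv_rpow,
          ENNReal.rpow_neg 2, inv_inv]
        ring

section RadialSingularities

variable {E : Type*} [NormedAddCommGroup E] [NormedSpace ℝ E] [MeasurableSpace E] [BorelSpace E]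
  [FiniteDimensional ℝ E] [Nontrivial E] (μ : Measure E) [μ.IsAddHaarMeasure]

theorem exists_setLIntegral_ball_norm_rpow_neg_mul_le {θ b s : ℝ} (hθ : 0 ≤ θ)
    (hθb : θ ≤ b - (Module.finrank ℝ E - 1)) (hθs : θ ≤ s)
    (hbs : b - (Module.finrank ℝ E - 1) + s - θ < 1) (R : ℝ) :
    ∃ C ≠ ∞, ∀ r : ℝ, ∫⁻ x in Metric.ball 0 R, ‖‖x‖‖ₑ ^ (-b) * ‖‖x‖ - r‖ₑ ^ (-s) ∂μ ≤
      C * ‖r‖ₑ ^ (-θ) := by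
  obtain ⟨C, hC, hle⟩ := exists_setLIntegral_Ioo_rpow_neg_mul_le hθ hθb hθs hbs R
  have hjacobian : ∀ v ∈ Set.Ioo 0 R, ENNReal.ofReal (v ^ (Module.finrank ℝ E - 1)) *
      ‖v‖ₑ ^ (-b) = ‖v‖ₑ ^ (-(b - (Module.finrank ℝ E - 1))) := fun v hv => by
    have hv0 : ‖v‖ₑ ≠ 0 := enorm_ne_zero.2 hv.1.ne'
    rw [← Real.enorm_eq_ofReal (pow_nonneg hv.1.le _), enorm_pow, ← ENNReal.rpow_natCast,
      ← ENNReal.rpow_add _ _ hv0 enorm_ne_top, Nat.cast_sub Module.finrank_pos, Nat.cast_one]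
    congr 1
    ring
  refine ⟨μ.toSphere Set.univ * C, ENNReal.mul_ne_top (measure_ne_top _ _) hC, fun r => ?_⟩
  rw [setLIntegral_ball_fun_norm μ (f := fun v => ‖v‖ₑ ^ (-b) * ‖v - r‖ₑ ^ (-s)) (by fun_prop) R,
    mul_assoc]
  gcongr
  refine (setLIntegral_congr_fun measurableSet_Ioo fun v hv => ?_).trans_le (hle r)
  simp only [← hjacobian v hv, mul_assoc]

end RadialSingularities

section ParametricIntegral

variable {H Y E F G : Type*} [NormedAddCommGroup H] [NormedSpace ℝ H]
  [NormedAddCommGroup Y] [NormedSpace ℝ Y] [NormedAddCommGroup E] [NormedSpace ℝ E]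
  [NormedAddCommGroup F] [NormedSpace ℝ F] [NormedAddCommGroup G] [NormedSpace ℝ G]

theorem hasFDerivAt_left_of_differentiableAt_uncurry {k : H → Y → E} {q : H} {y : Y}
    (hk : DifferentiableAt ℝ (Function.uncurry k) (q, y)) :
    HasFDerivAt (k · y)
      ((fderiv ℝ (Function.uncurry k) (q, y)).comp (ContinuousLinearMap.inl ℝ H Y)) q :=
  HasFDerivAt.comp (f := fun q' => (q', y)) q hk.hasFDerivAt (hasFDerivAt_prodMk_left q y)

theorem norm_fderiv_left_le_of_differentiableAt_uncurry {k : H → Y → E} {q : H} {y : Y}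
    (hk : DifferentiableAt ℝ (Function.uncurry k) (q, y)) :
    ‖fderiv ℝ (k · y) q‖ ≤ ‖fderiv ℝ (Function.uncurry k) (q, y)‖ := by
  rw [(hasFDerivAt_left_of_differentiableAt_uncurry hk).fderiv]
  refine (ContinuousLinearMap.opNorm_comp_le _ _).trans (mul_le_of_le_one_right (norm_nonneg _) ?_)
  exact ContinuousLinearMap.norm_inl_le_one ℝ H Y

variable {k : H → Y → E} {K : Set Y} {q : H}

theorem continuousOn_fderiv_left_of_contDiffAt
    (hk : ∀ y ∈ K, ContDiffAt ℝ 1 (Function.uncurry k) (q, y)) :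
    ContinuousOn (fun y => fderiv ℝ (k · y) q) K := by
  have hcont : ContinuousOn (fun y => fderiv ℝ (Function.uncurry k) (q, y)) K := fun y hy =>
    (((hk y hy).continuousAt_fderiv one_ne_zero).comp
      (by fun_prop : ContinuousAt (fun y => (q, y)) y)).continuousWithinAt
  have hcomp := hcont.clm_comp
    (continuousOn_const (c := ContinuousLinearMap.inl ℝ H Y) (s := K))
  exact hcomp.congr fun y hy => (hasFDerivAt_left_of_differentiableAt_uncurry
    ((hk y hy).differentiableAt one_ne_zero)).fderiv

theorem exists_eventually_norm_fderiv_left_le (hK : IsCompact K)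
    (hk : ∀ y ∈ K, ContDiffAt ℝ 1 (Function.uncurry k) (q, y)) :
    ∃ M : ℝ, ∀ᶠ q' in nhds q, ∀ y ∈ K,
      ContDiffAt ℝ 1 (Function.uncurry k) (q', y) ∧ ‖fderiv ℝ (k · y) q'‖ ≤ M := by
  have hcont : ∀ y ∈ K, ContinuousAt (fderiv ℝ (Function.uncurry k)) (q, y) := fun y hy =>
    (hk y hy).continuousAt_fderiv one_ne_zero
  obtain ⟨M, hM⟩ := hK.exists_bound_of_continuousOn (f := fun y =>
    fderiv ℝ (Function.uncurry k) (q, y)) fun y hy =>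
      ((hcont y hy).comp (by fun_prop : ContinuousAt (fun y => (q, y)) y)).continuousWithinAt
  refine ⟨M + 1, hK.eventually_forall_of_forall_eventually fun y hy => ?_⟩
  filter_upwards [(hk y hy).eventually (by simp),
    (hcont y hy).norm.eventually_lt_const ((hM y hy).trans_lt (lt_add_one M))] with z hz hzM
  exact ⟨hz, (norm_fderiv_left_le_of_differentiableAt_uncurry
    (hz.differentiableAt one_ne_zero)).trans hzM.le⟩

variable [MeasurableSpace Y] [BorelSpace Y] {μ : Measure Y} {g : Y → F} (B : E →L[ℝ] F →L[ℝ] G)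

theorem norm_precompL_apply_le (u : H →L[ℝ] E) (z : F) : ‖B.precompL H u z‖ ≤ ‖B‖ * ‖u‖ * ‖z‖ := by
  refine ContinuousLinearMap.opNorm_le_bound _ (by positivity) fun v => ?_
  calc ‖B (u v) z‖ ≤ ‖B‖ * ‖u v‖ * ‖z‖ := B.le_opNorm₂ _ _
    _ ≤ ‖B‖ * (‖u‖ * ‖v‖) * ‖z‖ := by gcongr; exact u.le_opNorm v
    _ = ‖B‖ * ‖u‖ * ‖z‖ * ‖v‖ := by ring

theorem integrable_precompL_fderiv_left (hK : IsCompact K) (hμ : ∀ᵐ y ∂μ, y ∈ K)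
    (hk : ∀ y ∈ K, ContDiffAt ℝ 1 (Function.uncurry k) (q, y)) (hg : Integrable g μ) :
    Integrable (fun y => B.precompL H (fderiv ℝ (k · y) q) (g y)) μ := by
  have hcont := continuousOn_fderiv_left_of_contDiffAt hk
  obtain ⟨M, hM⟩ := hK.exists_bound_of_continuousOn hcont
  refine (B.precompL H).integrable_of_bilin_of_bdd_left M ?_ (hμ.mono hM) hg
  rw [← Measure.restrict_eq_self_of_ae_mem hμ]
  exact hcont.aestronglyMeasurable_of_isCompact hK hK.measurableSet

theorem hasFDerivAt_integral_bilin_of_contDiffAt (hK : IsCompact K) (hμ : ∀ᵐ y ∂μ, y ∈ K)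
    (hk : ∀ y ∈ K, ContDiffAt ℝ 1 (Function.uncurry k) (q, y)) (hg : Integrable g μ) :
    HasFDerivAt (fun q' => ∫ y, B (k q' y) (g y) ∂μ)
      (∫ y, B.precompL H (fderiv ℝ (k · y) q) (g y) ∂μ) q := by
  obtain ⟨M, hM⟩ := exists_eventually_norm_fderiv_left_le hK hk
  have hcont : ∀ᶠ q' in nhds q, ContinuousOn (k q') K := hM.mono fun q' hq' y hy =>
    ((hq' y hy).1.continuousAt.comp
      (by fun_prop : ContinuousAt (fun y => (q', y)) y)).continuousWithinAt
  have hmeas : ∀ᶠ q' in nhds q, AEStronglyMeasurable (k q') μ := hcont.mono fun q' hq' => by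
    rw [← Measure.restrict_eq_self_of_ae_mem hμ]
    exact hq'.aestronglyMeasurable_of_isCompact hK hK.measurableSet
  obtain ⟨M₀, hM₀⟩ := hK.exists_bound_of_continuousOn hcont.self_of_nhds
  refine hasFDerivAt_integral_of_dominated_of_fderiv_le hM
    (bound := fun y => ‖B‖ * M * ‖g y‖)
    (F' := fun q' y => B.precompL H (fderiv ℝ (k · y) q') (g y))
    (hmeas.mono fun q' hq' => B.aestronglyMeasurable_comp₂ hq' hg.1)
    (B.integrable_of_bilin_of_bdd_left M₀ hmeas.self_of_nhds (hμ.mono hM₀) hg)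
    (integrable_precompL_fderiv_left B hK hμ hk hg).1 ?_ (hg.norm.const_mul _) ?_
  · filter_upwards [hμ] with y hy q' hq'
    refine (norm_precompL_apply_le B _ _).trans ?_
    gcongr
    exact (hq' y hy).2
  · filter_upwards [hμ] with y hy q' hq'
    have hd := (hasFDerivAt_left_of_differentiableAt_uncurry
      ((hq' y hy).1.differentiableAt one_ne_zero)).differentiableAt
    exact (B.flip (g y)).hasFDerivAt.comp q' hd.hasFDerivAt

end ParametricIntegral

section Paravector

variable {m : ℕ}

theorem vecNorm_nonneg (x : Para m) : 0 ≤ vecNorm x := Real.sqrt_nonneg _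

theorem vecNorm_sq (x : Para m) : vecNorm x ^ 2 = ∑ j : Fin m, x j.succ ^ 2 :=
  Real.sq_sqrt (Finset.sum_nonneg fun _ _ => sq_nonneg _)

theorem vecNorm_eq_norm_tail (x : Para m) :
    vecNorm x = ‖(WithLp.toLp 2 fun j : Fin m => x j.succ : EuclideanSpace ℝ (Fin m))‖ := by
  simp [vecNorm, EuclideanSpace.norm_eq]

theorem continuous_vecNorm : Continuous (vecNorm : Para m → ℝ) := by
  unfold vecNorm
  fun_prop

theorem vecNorm_add_le (x y : Para m) : vecNorm (x + y) ≤ vecNorm x + vecNorm y := by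
  rw [vecNorm_eq_norm_tail x, vecNorm_eq_norm_tail y]
  exact (vecNorm_eq_norm_tail (x + y)).trans_le (norm_add_le
    (WithLp.toLp 2 fun j : Fin m => x j.succ : EuclideanSpace ℝ (Fin m))
    (WithLp.toLp 2 fun j : Fin m => y j.succ))

theorem vecNorm_eq_zero_iff {x : Para m} : vecNorm x = 0 ↔ x ∈ realAxis m := by
  rw [← sq_eq_zero_iff, vecNorm_sq, Finset.sum_eq_zero_iff_of_nonneg fun _ _ => sq_nonneg _]
  simp [realAxis]

theorem norm_sq_eq_add_vecNorm_sq (x : Para m) : ‖x‖ ^ 2 = x 0 ^ 2 + vecNorm x ^ 2 := by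
  rw [EuclideanSpace.norm_sq_eq, Fin.sum_univ_succ, vecNorm_sq]
  simp only [Real.norm_eq_abs, sq_abs]

theorem vecNorm_le_norm (x : Para m) : vecNorm x ≤ ‖x‖ :=
  le_of_sq_le_sq (by rw [norm_sq_eq_add_vecNorm_sq]; linarith [sq_nonneg (x 0)]) (norm_nonneg x)

/-- The point `x₀ + i |x̲|` of the closed upper half plane representing `x` in every complex slice
`{u + J v}`. -/
noncomputable def halfPlane (x : Para m) : ℂ := ⟨x 0, vecNorm x⟩

theorem continuous_halfPlane : Continuous (halfPlane : Para m → ℂ) :=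
  Complex.equivRealProdCLM.symm.continuous.comp
    ((by fun_prop : Continuous fun x : Para m => x 0).prodMk continuous_vecNorm)

theorem dist_halfPlane_of_mem_realAxis {q : Para m} (hq : q ∈ realAxis m) (x : Para m) :
    dist (halfPlane q) (halfPlane x) = dist q x := by
  have htail : vecNorm (q - x) ^ 2 = vecNorm x ^ 2 := by
    rw [vecNorm_sq, vecNorm_sq]
    refine Finset.sum_congr rfl fun j _ => ?_
    rw [PiLp.sub_apply, hq j, zero_sub, neg_sq]
  rw [Complex.dist_eq_re_im, halfPlane, halfPlane, vecNorm_eq_zero_iff.2 hq, zero_sub, neg_sq,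
    ← htail, ← PiLp.sub_apply, ← norm_sq_eq_add_vecNorm_sq, Real.sqrt_sq (norm_nonneg _),
    dist_eq_norm]

end Paravector

section CliffordAlgebra

variable {m : ℕ}

theorem vec_eq_ι (x : Para m) : vec x = CliffordAlgebra.ι (negSumSq m) fun j => x j.succ := by
  have hsum := pi_eq_sum_univ' fun j : Fin m => x j.succ
  simp only [hsum, map_sum, map_smul, vec, e]

theorem vec_mul_vec_self (x : Para m) : vec x * vec x = -(vecNorm x ^ 2) • (1 : Cl m) := by
  rw [vec_eq_ι, CliffordAlgebra.ι_sq_scalar, negSumSq_apply, vecNorm_sq,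
    Algebra.algebraMap_eq_smul_one]

theorem toCl_eq (x : Para m) : toCl x = x 0 • (1 : Cl m) + vec x := by
  rw [toCl, Algebra.algebraMap_eq_smul_one]

theorem conjCl_eq (x : Para m) : conjCl x = x 0 • (1 : Cl m) - vec x := by
  rw [conjCl, Algebra.algebraMap_eq_smul_one]

theorem toCl_mul_conjCl (x : Para m) : toCl x * conjCl x = ‖x‖ ^ 2 • (1 : Cl m) := by
  rw [toCl_eq, conjCl_eq, norm_sq_eq_add_vecNorm_sq]
  simp only [mul_sub, add_mul, smul_mul_assoc, mul_smul_comm, one_mul, mul_one, vec_mul_vec_self]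
  module

theorem conjCl_mul_toCl (x : Para m) : conjCl x * toCl x = ‖x‖ ^ 2 • (1 : Cl m) := by
  rw [toCl_eq, conjCl_eq, norm_sq_eq_add_vecNorm_sq]
  simp only [mul_add, sub_mul, smul_mul_assoc, mul_smul_comm, one_mul, mul_one, vec_mul_vec_self]
  module

theorem toCl_sq (x : Para m) :
    toCl x ^ 2 = (2 * x 0) • toCl x - ‖x‖ ^ 2 • (1 : Cl m) := by
  rw [← conjCl_mul_toCl, sq, toCl_eq, conjCl_eq]
  simp only [mul_add, sub_mul, add_mul, smul_mul_assoc, mul_smul_comm, one_mul, mul_one]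
  module

theorem isUnit_toCl {x : Para m} (hx : x ≠ 0) : IsUnit (toCl x) := by
  have hx2 : ‖x‖ ^ 2 ≠ 0 := pow_ne_zero 2 (norm_ne_zero_iff.2 hx)
  exact isUnit_iff_exists.2 ⟨(‖x‖ ^ 2)⁻¹ • conjCl x,
    by rw [mul_smul_comm, toCl_mul_conjCl, inv_smul_smul₀ hx2],
    by rw [smul_mul_assoc, conjCl_mul_toCl, inv_smul_smul₀ hx2]⟩

theorem ring_inverse_toCl (x : Para m) :
    Ring.inverse (toCl x) = (‖x‖ ^ 2)⁻¹ • conjCl x := by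
  rcases eq_or_ne x 0 with rfl | hx
  · simp [toCl, vec]
  refine (isUnit_toCl hx).mul_left_cancel ?_
  rw [Ring.mul_inverse_cancel _ (isUnit_toCl hx), mul_smul_comm, toCl_mul_conjCl,
    inv_smul_smul₀ (pow_ne_zero 2 (norm_ne_zero_iff.2 hx))]

/-- The embedding `toCl` of paravectors as a continuous linear map. -/
noncomputable def toClL (m : ℕ) : Para m →L[ℝ] Cl m :=
  (EuclideanSpace.proj 0).smulRight 1 + ∑ j, (EuclideanSpace.proj (Fin.succ j)).smulRight (e j)

/-- The conjugation `conjCl` of paravectors as a continuous linear map. -/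
noncomputable def conjClL (m : ℕ) : Para m →L[ℝ] Cl m :=
  (EuclideanSpace.proj 0).smulRight 1 - ∑ j, (EuclideanSpace.proj (Fin.succ j)).smulRight (e j)

theorem toClL_apply (x : Para m) : toClL m x = toCl x := by
  simp [toClL, toCl_eq, vec]

theorem conjClL_apply (x : Para m) : conjClL m x = conjCl x := by
  simp [conjClL, conjCl_eq, vec]

/-- The multiplication of the Clifford algebra as a continuous bilinear map. The norm of `Cl m` is
not submultiplicative for `3 ≤ m`, so that `‖mulL m‖` appears as a constant in norm estimates. -/
noncomputable def mulL (m : ℕ) : Cl m →L[ℝ] Cl m →L[ℝ] Cl m :=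
  (LinearMap.mul ℝ (Cl m)).toContinuousBilinearMap

theorem mulL_apply (a b : Cl m) : mulL m a b = a * b := rfl

end CliffordAlgebra

section Kernel

open ComplexConjugate

variable {m : ℕ}

/-- The paravector `q² - 2 x₀ q + |x|²`, the denominator of the slice Cauchy kernel; see
`toCl_companion`. -/
noncomputable def companion (q x : Para m) : Para m :=
  (‖x‖ ^ 2 - ‖q‖ ^ 2) • EuclideanSpace.single 0 1 + (2 * (q 0 - x 0)) • q

theorem toCl_single_zero : toCl (EuclideanSpace.single 0 1 : Para m) = 1 := by
  simp [toCl, vec]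

theorem toCl_companion (q x : Para m) :
    toCl (companion q x) =
      toCl q ^ 2 - (2 * x 0) • toCl q + algebraMap ℝ (Cl m) (‖x‖ ^ 2) := by
  rw [companion, ← toClL_apply, map_add, map_smul, map_smul, toClL_apply, toClL_apply,
    toCl_single_zero, toCl_sq, Algebra.algebraMap_eq_smul_one]
  module

theorem norm_companion (q x : Para m) :
    ‖companion q x‖ =
      ‖halfPlane q - halfPlane x‖ * ‖conj (halfPlane q) - halfPlane x‖ := by
  have hzero : companion q x 0 = (q 0 - x 0) ^ 2 - vecNorm q ^ 2 + vecNorm x ^ 2 := by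
    simp only [companion, norm_sq_eq_add_vecNorm_sq, PiLp.add_apply, PiLp.smul_apply,
      PiLp.single_apply, smul_eq_mul, if_true]
    ring
  have hvec : vecNorm (companion q x) ^ 2 = (2 * (q 0 - x 0)) ^ 2 * vecNorm q ^ 2 := by
    simp [companion, vecNorm_sq, mul_pow, Finset.mul_sum]
  rw [← sq_eq_sq₀ (norm_nonneg _) (by positivity), mul_pow, norm_sq_eq_add_vecNorm_sq, hzero, hvec,
    Complex.sq_norm, Complex.sq_norm, Complex.normSq_apply, Complex.normSq_apply]
  simp only [halfPlane, Complex.sub_re, Complex.sub_im, Complex.conj_re, Complex.conj_im]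
  ring

theorem contDiff_companion :
    ContDiff ℝ 1 fun z : Para m × Para m => companion z.1 z.2 := by
  have hfst : ContDiff ℝ 1 (Prod.fst : Para m × Para m → Para m) := contDiff_fst
  have hsnd : ContDiff ℝ 1 (Prod.snd : Para m × Para m → Para m) := contDiff_snd
  have hsub : ContDiff ℝ 1 fun z : Para m × Para m => z.1 0 - z.2 0 := by fun_prop
  exact (((hsnd.norm_sq ℝ).sub (hfst.norm_sq ℝ)).smul contDiff_const).add
    ((contDiff_const.mul hsub).smul hfst)

theorem sliceCauchyKernel_eq (q x : Para m) :
    sliceCauchyKernel q x =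
      -((‖companion q x‖ ^ 2)⁻¹ • (conjCl (companion q x) * (toCl q - conjCl x))) := by
  rw [sliceCauchyKernel, ← toCl_companion, ring_inverse_toCl, smul_mul_assoc]

theorem norm_toCl_sub_conjCl_le (q x : Para m) :
    ‖toCl q - conjCl x‖ ≤ ‖toClL m‖ * ‖conj (halfPlane q) - halfPlane x‖ := by
  set y : Para m := q + x - (2 * x 0) • EuclideanSpace.single 0 1 with hy
  have hzero : y 0 = q 0 - x 0 := by
    simp only [hy, PiLp.sub_apply, PiLp.add_apply, PiLp.smul_apply, PiLp.single_apply,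
      smul_eq_mul, if_true]
    ring
  have hvec : vecNorm y = vecNorm (q + x) := by
    simp [hy, vecNorm]
  have htoCl : toCl q - conjCl x = toCl y := by
    rw [hy, ← toClL_apply y, hy, map_sub, map_add, map_smul, toClL_apply, toClL_apply, toClL_apply,
      toCl_single_zero, conjCl_eq, toCl_eq x]
    module
  have hnorm : ‖y‖ ^ 2 ≤ ‖conj (halfPlane q) - halfPlane x‖ ^ 2 := by
    rw [norm_sq_eq_add_vecNorm_sq, hzero, hvec, Complex.sq_norm, Complex.normSq_apply]
    simp only [halfPlane, Complex.sub_re, Complex.sub_im, Complex.conj_re, Complex.conj_im]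
    have hadd := pow_le_pow_left₀ (vecNorm_nonneg _) (vecNorm_add_le q x) 2
    linarith
  rw [htoCl, ← toClL_apply]
  refine ((toClL m).le_opNorm y).trans ?_
  gcongr
  exact le_of_sq_le_sq hnorm (norm_nonneg _)

theorem exists_norm_sliceCauchyKernel_le (m : ℕ) :
    ∃ C : ℝ≥0, ∀ q x : Para m,
      ‖sliceCauchyKernel q x‖ ≤ C * ‖halfPlane q - halfPlane x‖⁻¹ := by
  refine ⟨‖mulL m‖₊ * ‖conjClL m‖₊ * ‖toClL m‖₊, fun q x => ?_⟩
  calc ‖sliceCauchyKernel q x‖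
      = (‖companion q x‖ ^ 2)⁻¹ * ‖conjClL m (companion q x) * (toCl q - conjCl x)‖ := by
        rw [sliceCauchyKernel_eq, norm_neg, norm_smul, norm_inv, norm_pow, norm_norm,
          conjClL_apply]
    _ ≤ (‖companion q x‖ ^ 2)⁻¹ * (‖mulL m‖ * (‖conjClL m‖ * ‖companion q x‖) *
          (‖toClL m‖ * ‖conj (halfPlane q) - halfPlane x‖)) := by
        gcongr
        refine ((mulL m).le_opNorm₂ _ _).trans ?_
        gcongr
        · exact (conjClL m).le_opNorm _
        · exact norm_toCl_sub_conjCl_le q x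
    _ = ‖mulL m‖ * ‖conjClL m‖ * ‖toClL m‖ * (‖companion q x‖⁻¹ *
          ‖conj (halfPlane q) - halfPlane x‖) := by
        field
    _ ≤ ‖mulL m‖ * ‖conjClL m‖ * ‖toClL m‖ * ‖halfPlane q - halfPlane x‖⁻¹ := by
        gcongr
        rw [norm_companion, mul_inv, mul_assoc]
        exact mul_le_of_le_one_right (by positivity) inv_mul_le_one

/-- The scalar factor `2 / (ω |x̲|^{m-1})` of the kernel `K(q, x)`. -/
noncomputable def kernelWeight (x : Para m) : ℝ := 2 / (sphereArea m * vecNorm x ^ (m - 1))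

theorem measurable_kernelWeight : Measurable (kernelWeight : Para m → ℝ) := by
  have := (continuous_vecNorm (m := m)).measurable
  unfold kernelWeight
  fun_prop

theorem enorm_kernelWeight_le (hm : 1 ≤ m) (x : Para m) :
    ‖kernelWeight x‖ₑ ≤ ‖2 / sphereArea m‖ₑ * ‖vecNorm x‖ₑ ^ (-(m - 1 : ℝ)) := by
  have hexp : (m - 1 : ℝ) = (m - 1 : ℕ) := by
    rw [Nat.cast_sub hm, Nat.cast_one]
  rw [kernelWeight, ← div_div, div_eq_mul_inv (2 / sphereArea m), enorm_mul, hexp,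
    ENNReal.rpow_neg, ENNReal.rpow_natCast, ← enorm_pow]
  gcongr
  rcases eq_or_ne (vecNorm x ^ (m - 1)) 0 with h | h
  · simp [h]
  · exact (enorm_inv h).le

theorem exists_enorm_kernelK_le (hm : 1 ≤ m) :
    ∃ C : ℝ≥0, ∀ q x : Para m, ‖kernelK q x‖ₑ ≤
      C * (‖vecNorm x‖ₑ ^ (-(m - 1 : ℝ)) * ‖halfPlane q - halfPlane x‖ₑ⁻¹) := by
  obtain ⟨C, hC⟩ := exists_norm_sliceCauchyKernel_le m
  have hC' : ∀ q x : Para m,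
      ‖sliceCauchyKernel q x‖ₑ ≤ C * ‖halfPlane q - halfPlane x‖ₑ⁻¹ := fun q x => by
    have h : ‖sliceCauchyKernel q x‖₊ ≤ C * ‖halfPlane q - halfPlane x‖₊⁻¹ := hC q x
    calc ‖sliceCauchyKernel q x‖ₑ ≤ C * (‖halfPlane q - halfPlane x‖₊⁻¹ : ℝ≥0) := mod_cast h
      _ ≤ _ := by
        gcongr
        exact ENNReal.coe_inv_le
  refine ⟨‖2 / sphereArea m‖₊ * C, fun q x => ?_⟩
  calc ‖kernelK q x‖ₑ = ‖kernelWeight x‖ₑ * ‖sliceCauchyKernel q x‖ₑ := enorm_smul _ _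
    _ ≤ ‖2 / sphereArea m‖ₑ * ‖vecNorm x‖ₑ ^ (-(m - 1 : ℝ)) *
          (C * ‖halfPlane q - halfPlane x‖ₑ⁻¹) := by
        gcongr
        exacts [enorm_kernelWeight_le hm x, hC' q x]
    _ = _ := by
        rw [ENNReal.coe_mul, enorm_eq_nnnorm (2 / sphereArea m)]
        ring

theorem stronglyMeasurable_kernelK :
    StronglyMeasurable fun z : Para m × Para m => kernelK z.1 z.2 := by
  have hcompanion := (contDiff_companion (m := m)).continuous
  have hnum : Continuous fun z : Para m × Para m =>
      mulL m (conjClL m (companion z.1 z.2)) (toClL m z.1 - conjClL m z.2) := by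
    fun_prop
  have hweight : Measurable fun z : Para m × Para m => kernelWeight z.2 :=
    measurable_kernelWeight.comp measurable_snd
  simp only [mulL_apply, conjClL_apply, toClL_apply] at hnum
  change StronglyMeasurable fun z : Para m × Para m =>
    kernelWeight z.2 • sliceCauchyKernel z.1 z.2
  simp only [sliceCauchyKernel_eq]
  exact hweight.stronglyMeasurable.smul
    ((hcompanion.norm.pow 2).measurable.inv.stronglyMeasurable.smul hnum.stronglyMeasurable).neg

end Kernel

section KernelIntegral

variable {m : ℕ}

theorem measurePreserving_prodMk_tail :
    MeasurePreserving (fun x : Para m =>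
      (x 0, (WithLp.toLp 2 fun j : Fin m => x j.succ : EuclideanSpace ℝ (Fin m)))) := by
  have hsplit := (volume_preserving_piFinSuccAbove (fun _ : Fin (m + 1) => ℝ) 0).comp
    (PiLp.volume_preserving_ofLp (Fin (m + 1)))
  exact ((MeasurePreserving.id volume).prod (PiLp.volume_preserving_toLp (Fin m))).comp hsplit

theorem setLIntegral_ball_mul_vecNorm_le {g h : ℝ → ℝ≥0∞} (hg : Measurable g) (hh : Measurable h)
    (R : ℝ) :
    ∫⁻ x in Metric.ball (0 : Para m) R, g (x 0) * h (vecNorm x) ≤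
      (∫⁻ u in Metric.ball 0 R, g u) *
        ∫⁻ y in Metric.ball (0 : EuclideanSpace ℝ (Fin m)) R, h ‖y‖ := by
  have hsub : Metric.ball (0 : Para m) R ⊆ (fun x : Para m =>
      (x 0, (WithLp.toLp 2 fun j : Fin m => x j.succ : EuclideanSpace ℝ (Fin m)))) ⁻¹'
        (Metric.ball 0 R ×ˢ Metric.ball 0 R) := fun x hx => by
    rw [mem_ball_zero_iff] at hx
    rw [Set.mem_preimage, Set.mem_prod, mem_ball_zero_iff, mem_ball_zero_iff,
      ← vecNorm_eq_norm_tail]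
    exact ⟨(PiLp.norm_apply_le x 0).trans_lt hx, (vecNorm_le_norm x).trans_lt hx⟩
  refine (lintegral_mono_set hsub).trans_eq ?_
  simp only [vecNorm_eq_norm_tail]
  rw [measurePreserving_prodMk_tail.setLIntegral_comp_preimage
    (measurableSet_ball.prod measurableSet_ball) (f := fun z => g z.1 * h ‖z.2‖) (by fun_prop),
    Measure.volume_eq_prod, ← Measure.prod_restrict]
  exact lintegral_prod_mul hg.aemeasurable (hh.comp measurable_norm).aemeasurable

theorem setLIntegral_ball_vecNorm_rpow_neg_lt_top (hm : 1 ≤ m) {b : ℝ} (hb : b < m) (R : ℝ) :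
    ∫⁻ x in Metric.ball (0 : Para m) R, ‖vecNorm x‖ₑ ^ (-b) < ∞ := by
  have : Nonempty (Fin m) := ⟨⟨0, hm⟩⟩
  have hle := setLIntegral_ball_mul_vecNorm_le (m := m) (g := 1) (h := fun v => ‖v‖ₑ ^ (-b))
    measurable_const (by fun_prop) R
  simp only [Pi.one_apply, one_mul, setLIntegral_one, enorm_norm] at hle
  exact hle.trans_lt (ENNReal.mul_lt_top measure_ball_lt_top
    (setLIntegral_ball_enorm_rpow_neg_lt_top volume (by simpa using hb) R))

theorem enorm_halfPlane_sub_rpow_neg_le (q x : Para m) {s t : ℝ} (ht : 0 ≤ t) (hs : 0 ≤ s) :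
    ‖halfPlane q - halfPlane x‖ₑ ^ (-(t + s)) ≤
      ‖x 0 - q 0‖ₑ ^ (-t) * ‖vecNorm x - vecNorm q‖ₑ ^ (-s) := by
  have hre : ‖x 0 - q 0‖ₑ ≤ ‖halfPlane q - halfPlane x‖ₑ := by
    rw [enorm_sub_rev]
    exact enorm_le_iff_norm_le.2 (Complex.abs_re_le_norm (halfPlane q - halfPlane x))
  have him : ‖vecNorm x - vecNorm q‖ₑ ≤ ‖halfPlane q - halfPlane x‖ₑ := by
    rw [enorm_sub_rev]
    exact enorm_le_iff_norm_le.2 (Complex.abs_im_le_norm (halfPlane q - halfPlane x))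
  rw [ennreal_rpow_neg_add _ ht hs]
  exact mul_le_mul' (ennreal_rpow_neg_le_rpow_neg hre ht) (ennreal_rpow_neg_le_rpow_neg him hs)

theorem exists_enorm_kernelK_rpow_le (hm : 1 ≤ m) {s t : ℝ} (ht : 0 ≤ t) (hs : 0 ≤ s) :
    ∃ C ≠ ∞, ∀ q x : Para m, ‖kernelK q x‖ₑ ^ (t + s) ≤ C * (‖x 0 - q 0‖ₑ ^ (-t) *
      (‖vecNorm x‖ₑ ^ (-((m - 1) * (t + s))) * ‖vecNorm x - vecNorm q‖ₑ ^ (-s))) := by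
  obtain ⟨C, hC⟩ := exists_enorm_kernelK_le hm
  have hst : 0 ≤ t + s := add_nonneg ht hs
  refine ⟨(C : ℝ≥0∞) ^ (t + s), by finiteness, fun q x => ?_⟩
  calc ‖kernelK q x‖ₑ ^ (t + s)
      ≤ (C * (‖vecNorm x‖ₑ ^ (-(m - 1 : ℝ)) * ‖halfPlane q - halfPlane x‖ₑ⁻¹)) ^ (t + s) := by
        gcongr
        exact hC q x
    _ = (C : ℝ≥0∞) ^ (t + s) * (‖vecNorm x‖ₑ ^ (-((m - 1) * (t + s))) *
          ‖halfPlane q - halfPlane x‖ₑ ^ (-(t + s))) := by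
        rw [ENNReal.mul_rpow_of_nonneg _ _ hst, ENNReal.mul_rpow_of_nonneg _ _ hst,
          ← ENNReal.rpow_mul, neg_mul, ENNReal.inv_rpow, ENNReal.rpow_neg _ (t + s)]
    _ ≤ (C : ℝ≥0∞) ^ (t + s) * (‖vecNorm x‖ₑ ^ (-((m - 1) * (t + s))) *
          (‖x 0 - q 0‖ₑ ^ (-t) * ‖vecNorm x - vecNorm q‖ₑ ^ (-s))) := by
        gcongr
        exact enorm_halfPlane_sub_rpow_neg_le q x ht hs
    _ = _ := by ring

theorem exists_setLIntegral_enorm_kernelK_rpow_le (hm : 1 ≤ m) {P θ : ℝ} (hP : 1 < P)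
    (hθ : 0 ≤ θ) (hθP : θ ≤ (m - 1) * (P - 1)) (hP₁ : (m - 1) * (P - 1) < 1)
    (hPθ : m * (P - 1) < 1 + θ) (R : ℝ) :
    ∃ C ≠ ∞, ∀ q : Para m, ∫⁻ x in Metric.ball 0 R, ‖kernelK q x‖ₑ ^ P ≤
      C * ‖vecNorm q‖ₑ ^ (-θ) := by
  have : Nonempty (Fin m) := ⟨⟨0, hm⟩⟩
  obtain ⟨s, hs, hs₁⟩ : ∃ s, max (P - 1) θ < s ∧ s < 1 - (m - 1) * (P - 1) + θ :=
    exists_between (max_lt (by linarith) (by linarith))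
  obtain ⟨hPs, hθs⟩ := max_lt_iff.1 hs
  have hs₀ : 0 ≤ s := hθ.trans hθs.le
  have hsP : 0 ≤ P - s := by linarith
  obtain ⟨C₀, hC₀, hK⟩ := exists_enorm_kernelK_rpow_le hm hsP hs₀
  obtain ⟨C₁, hC₁, hint₁⟩ := exists_setLIntegral_ball_enorm_sub_rpow_neg_le (volume : Measure ℝ)
    (s := P - s) hsP (by rw [Module.finrank_self, Nat.cast_one]; linarith) R
  obtain ⟨C₂, hC₂, hint₂⟩ := exists_setLIntegral_ball_norm_rpow_neg_mul_le
    (volume : Measure (EuclideanSpace ℝ (Fin m))) (b := (m - 1) * P) hθ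
    (by rw [finrank_euclideanSpace_fin]; linarith) hθs.le
    (by rw [finrank_euclideanSpace_fin]; linarith) R
  rw [sub_add_cancel] at hK
  refine ⟨C₀ * (C₁ * C₂), by finiteness, fun q => ?_⟩
  calc ∫⁻ x in Metric.ball 0 R, ‖kernelK q x‖ₑ ^ P
      ≤ C₀ * ∫⁻ x in Metric.ball (0 : Para m) R, ‖x 0 - q 0‖ₑ ^ (-(P - s)) *
          (‖vecNorm x‖ₑ ^ (-((m - 1) * P)) * ‖vecNorm x - vecNorm q‖ₑ ^ (-s)) := by
        rw [← lintegral_const_mul' _ _ hC₀]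
        exact lintegral_mono fun x => hK q x
    _ ≤ C₀ * (C₁ * (C₂ * ‖vecNorm q‖ₑ ^ (-θ))) := by
        gcongr
        refine (setLIntegral_ball_mul_vecNorm_le (g := fun u => ‖u - q 0‖ₑ ^ (-(P - s)))
          (h := fun v => ‖v‖ₑ ^ (-((m - 1) * P)) * ‖v - vecNorm q‖ₑ ^ (-s))
          (by fun_prop) (by fun_prop) R).trans ?_
        gcongr
        exacts [hint₁ (q 0), hint₂ (vecNorm q)]
    _ = _ := by ring

end KernelIntegral

section Boundedness

variable {m : ℕ} {Ω : Set (Para m)} {p P : ℝ} {f : Para m → Cl m}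

theorem eLpNorm_ofReal_eq_lintegral {α E : Type*} [MeasurableSpace α] [NormedAddCommGroup E]
    {r : ℝ} (hr : 0 < r) (g : α → E) (μ : Measure α) :
    eLpNorm g (ENNReal.ofReal r) μ = (∫⁻ x, ‖g x‖ₑ ^ r ∂μ) ^ (1 / r) := by
  rw [eLpNorm_eq_lintegral_rpow_enorm_toReal (by simpa using hr) ENNReal.ofReal_ne_top,
    ENNReal.toReal_ofReal hr.le]

theorem exists_eLpNorm_kernelK_le_of_exponent (hm : 1 ≤ m) (hΩ : Bornology.IsBounded Ω) {θ : ℝ}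
    (hP : 1 < P) (hθ : 0 ≤ θ) (hθP : θ ≤ (m - 1) * (P - 1)) (hP₁ : (m - 1) * (P - 1) < 1)
    (hPθ : m * (P - 1) < 1 + θ) :
    ∃ C ≠ ∞, ∀ q : Para m, eLpNorm (kernelK q) (ENNReal.ofReal P) (volume.restrict Ω) ≤
      C * ‖vecNorm q‖ₑ ^ (-(θ / P)) := by
  obtain ⟨R, hR⟩ := hΩ.subset_ball 0
  obtain ⟨C, hC, hint⟩ := exists_setLIntegral_enorm_kernelK_rpow_le hm hP hθ hθP hP₁ hPθ R
  have hP₀ : 0 < P := zero_lt_one.trans hP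
  refine ⟨C ^ (1 / P), by finiteness, fun q => ?_⟩
  calc eLpNorm (kernelK q) (ENNReal.ofReal P) (volume.restrict Ω)
      ≤ (C * ‖vecNorm q‖ₑ ^ (-θ)) ^ (1 / P) := by
        rw [eLpNorm_ofReal_eq_lintegral hP₀]
        gcongr
        exact (lintegral_mono_set hR).trans (hint q)
    _ = C ^ (1 / P) * ‖vecNorm q‖ₑ ^ (-(θ / P)) := by
        rw [ENNReal.mul_rpow_of_nonneg _ _ (by positivity), ← ENNReal.rpow_mul, neg_mul,
          mul_one_div]

theorem conjExponent_sub_one (hpP : p.HolderConjugate P) : P - 1 = (p - 1)⁻¹ := by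
  rw [hpP.conjugate_eq, div_sub_one hpP.sub_one_ne_zero, sub_sub_cancel, one_div]

theorem exists_eLpNorm_kernelK_le_rpow (hm : 1 ≤ m) (hΩ : Bornology.IsBounded Ω)
    (hpP : p.HolderConjugate P) (hp : max (m : ℝ) 2 < p) :
    ∃ C ≠ ∞, ∀ q : Para m, eLpNorm (kernelK q) (ENNReal.ofReal P) (volume.restrict Ω) ≤
      C * ‖vecNorm q‖ₑ ^ (-((m - 1) / p)) := by
  obtain ⟨hmp, hp₂⟩ := max_lt_iff.1 hp
  have hp₁ : 0 < p - 1 := hpP.sub_one_pos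
  have hm₁ : (0 : ℝ) ≤ m - 1 := sub_nonneg.2 (mod_cast hm)
  have hP : P - 1 < 1 := by
    rw [conjExponent_sub_one hpP, inv_lt_one₀ hp₁]
    linarith
  have hP₀ : 0 < P - 1 := hpP.symm.sub_one_pos
  have hP₁ : (m - 1) * (P - 1) < 1 := by
    rw [conjExponent_sub_one hpP, ← div_eq_mul_inv, div_lt_one hp₁]
    linarith
  have hexp : (m - 1) * (P - 1) / P = (m - 1) / p := by
    rw [conjExponent_sub_one hpP, hpP.conjugate_eq]
    field
  rw [← hexp]
  exact exists_eLpNorm_kernelK_le_of_exponent hm hΩ hpP.symm.lt (by positivity) le_rfl hP₁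
    (by linarith)

theorem exists_eLpNorm_kernelK_le_const (hm : 1 ≤ m) (hΩ : Bornology.IsBounded Ω)
    (hpP : p.HolderConjugate P) (hp : (m : ℝ) + 1 < p) :
    ∃ C ≠ ∞, ∀ q : Para m,
      eLpNorm (kernelK q) (ENNReal.ofReal P) (volume.restrict Ω) ≤ C := by
  have hm₁ : (0 : ℝ) ≤ m - 1 := sub_nonneg.2 (mod_cast hm)
  have hP₀ : 0 < P - 1 := hpP.symm.sub_one_pos
  have hmP : m * (P - 1) < 1 := by
    rw [conjExponent_sub_one hpP, ← div_eq_mul_inv, div_lt_one hpP.sub_one_pos]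
    linarith
  simpa using exists_eLpNorm_kernelK_le_of_exponent hm hΩ hpP.symm.lt le_rfl (by positivity)
    (by linarith) (by linarith)

theorem memLp_kernelWeight (hm : 1 ≤ m) (hΩ : Bornology.IsBounded Ω) (hP : 0 < P)
    (hPm : (m - 1) * P < m) :
    MemLp (kernelWeight : Para m → ℝ) (ENNReal.ofReal P) (volume.restrict Ω) := by
  obtain ⟨R, hR⟩ := hΩ.subset_ball 0
  refine ⟨measurable_kernelWeight.aestronglyMeasurable, ?_⟩
  rw [eLpNorm_ofReal_eq_lintegral hP]
  refine ENNReal.rpow_lt_top_of_nonneg (by positivity) (ne_of_lt ?_)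
  calc ∫⁻ x in Ω, ‖kernelWeight x‖ₑ ^ P
      ≤ ∫⁻ x in Metric.ball (0 : Para m) R,
          ‖2 / sphereArea m‖ₑ ^ P * ‖vecNorm x‖ₑ ^ (-((m - 1) * P)) := by
        refine (lintegral_mono_set hR).trans (lintegral_mono fun x => ?_)
        rw [← neg_mul, ENNReal.rpow_mul, ← ENNReal.mul_rpow_of_nonneg _ _ hP.le]
        exact ENNReal.rpow_le_rpow (enorm_kernelWeight_le hm x) hP.le
    _ < ∞ := by
        rw [lintegral_const_mul' _ _ (by finiteness)]
        exact ENNReal.mul_lt_top (by finiteness)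
          (setLIntegral_ball_vecNorm_rpow_neg_lt_top hm hPm R)

theorem aestronglyMeasurable_kernelK (μ : Measure (Para m)) (q : Para m) :
    AEStronglyMeasurable (kernelK q) μ :=
  (stronglyMeasurable_kernelK.comp_measurable measurable_prodMk_left).aestronglyMeasurable

theorem ae_mem_closure (Ω : Set (Para m)) : ∀ᵐ x ∂volume.restrict Ω, x ∈ closure Ω :=
  ae_restrict_of_ae_restrict_of_subset subset_closure
    (ae_restrict_mem isClosed_closure.measurableSet)

theorem ae_halfPlane_mem_closure (Ω : Set (Para m)) :
    ∀ᵐ x ∂volume.restrict Ω, halfPlane x ∈ closure (halfPlane '' Ω) :=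
  (ae_mem_closure Ω).mono fun _ hx =>
    map_mem_closure continuous_halfPlane hx (Set.mapsTo_image _ _)

theorem exists_norm_sliceCauchyKernel_le_of_notMem_closure {q : Para m} {D : Set ℂ}
    (hq : halfPlane q ∉ closure D) :
    ∃ C : ℝ, ∀ x : Para m, halfPlane x ∈ closure D → ‖sliceCauchyKernel q x‖ ≤ C := by
  obtain ⟨C, hC⟩ := exists_norm_sliceCauchyKernel_le m
  rw [← closure_closure, Metric.mem_closure_iff] at hq
  push Not at hq
  obtain ⟨ε, hε, hdist⟩ := hq
  refine ⟨C * ε⁻¹, fun x hx => (hC q x).trans ?_⟩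
  gcongr
  exact (hdist _ hx).trans_eq (dist_eq_norm _ _)

theorem memLp_kernelK_of_notMem_closure (hm : 1 ≤ m) (hΩ : Bornology.IsBounded Ω) (hP : 0 < P)
    (hPm : (m - 1) * P < m) {q : Para m} (hq : halfPlane q ∉ closure (halfPlane '' Ω)) :
    MemLp (kernelK q) (ENNReal.ofReal P) (volume.restrict Ω) := by
  obtain ⟨C, hC⟩ := exists_norm_sliceCauchyKernel_le_of_notMem_closure hq
  refine (memLp_kernelWeight hm hΩ hP hPm).of_le_mul (c := C)
    (aestronglyMeasurable_kernelK _ q) ?_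
  filter_upwards [ae_halfPlane_mem_closure Ω] with x hx
  calc ‖kernelK q x‖ = ‖kernelWeight x‖ * ‖sliceCauchyKernel q x‖ := norm_smul _ _
    _ ≤ C * ‖kernelWeight x‖ := by
      rw [mul_comm]
      gcongr
      exact hC x hx

theorem notMem_closure_image_halfPlane {q : Para m} (hq : q ∈ realAxis m) (hqΩ : q ∉ closure Ω) :
    halfPlane q ∉ closure (halfPlane '' Ω) := by
  rw [Metric.mem_closure_iff] at hqΩ ⊢
  simpa only [Set.exists_mem_image, dist_halfPlane_of_mem_realAxis hq] using hqΩ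

theorem sub_one_mul_lt_of_lt (hpP : p.HolderConjugate P) (hmp : (m : ℝ) < p) :
    (m - 1) * P < m := by
  have hP₁ : (m - 1) * (P - 1) < 1 := by
    rw [conjExponent_sub_one hpP, ← div_eq_mul_inv, div_lt_one hpP.sub_one_pos]
    linarith
  linarith

theorem memLp_kernelK (hm : 1 ≤ m) (hΩ : Bornology.IsBounded Ω)
    (hpP : p.HolderConjugate P) (hp : max (m : ℝ) 2 < p) {q : Para m}
    (hq : q ∉ closure Ω ∩ realAxis m ∨ (m : ℝ) + 1 < p) :
    MemLp (kernelK q) (ENNReal.ofReal P) (volume.restrict Ω) := by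
  rcases hq with hq | hp'
  · by_cases hreal : q ∈ realAxis m
    · exact memLp_kernelK_of_notMem_closure hm hΩ hpP.symm.pos
        (sub_one_mul_lt_of_lt hpP ((le_max_left _ _).trans_lt hp))
        (notMem_closure_image_halfPlane hreal fun hcl => hq ⟨hcl, hreal⟩)
    · obtain ⟨C, hC, hle⟩ := exists_eLpNorm_kernelK_le_rpow hm hΩ hpP hp
      refine ⟨aestronglyMeasurable_kernelK _ q,
        (hle q).trans_lt (ENNReal.mul_lt_top hC.lt_top ?_)⟩
      exact (ENNReal.rpow_ne_top_of_ne_zero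
        (enorm_ne_zero.2 (vecNorm_eq_zero_iff.not.2 hreal)) enorm_ne_top).lt_top
  · obtain ⟨C, hC, hle⟩ := exists_eLpNorm_kernelK_le_const hm hΩ hpP hp'
    exact ⟨aestronglyMeasurable_kernelK _ q, (hle q).trans_lt hC.lt_top⟩

theorem integrableOn_kernelK_mul (hpP : p.HolderConjugate P)
    (hf : MemLp f (ENNReal.ofReal p) (volume.restrict Ω)) {q : Para m}
    (hK : MemLp (kernelK q) (ENNReal.ofReal P) (volume.restrict Ω)) :
    IntegrableOn (fun x => kernelK q x * f x) Ω := by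
  have := hpP.symm.ennrealOfReal
  exact memLp_one_iff_integrable.1 ((mulL m).memLp_of_bilin 1 hK hf)

theorem aestronglyMeasurable_teodorescu
    (hf : AEStronglyMeasurable f (volume.restrict Ω)) :
    AEStronglyMeasurable (teodorescu Ω f) (volume.restrict Ω) := by
  have hprod : AEStronglyMeasurable (fun z : Para m × Para m => kernelK z.1 z.2 * f z.2)
      ((volume.restrict Ω).prod (volume.restrict Ω)) :=
    (mulL m).aestronglyMeasurable_comp₂ stronglyMeasurable_kernelK.aestronglyMeasurable
      hf.comp_snd
  exact (hprod.integral_prod_right'.const_smul (1 / (2 * Real.pi))).neg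

theorem enorm_teodorescu_le (hpP : p.HolderConjugate P)
    (hf : AEStronglyMeasurable f (volume.restrict Ω)) (q : Para m) :
    ‖teodorescu Ω f q‖ₑ ≤ ‖1 / (2 * Real.pi)‖ₑ * (‖mulL m‖ₑ *
      eLpNorm (kernelK q) (ENNReal.ofReal P) (volume.restrict Ω) *
        eLpNorm f (ENNReal.ofReal p) (volume.restrict Ω)) := by
  have := hpP.symm.ennrealOfReal
  rw [teodorescu, enorm_neg, enorm_smul]
  gcongr
  calc ‖∫ x in Ω, kernelK q x * f x‖ₑ
      ≤ eLpNorm (fun x => kernelK q x * f x) 1 (volume.restrict Ω) := by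
        rw [eLpNorm_one_eq_lintegral_enorm]
        exact enorm_integral_le_lintegral_enorm _
    _ ≤ _ := eLpNorm_le_eLpNorm_mul_eLpNorm_of_nnnorm
        (aestronglyMeasurable_kernelK _ q) hf (fun a b : Cl m => a * b) ‖mulL m‖₊
        (.of_forall fun x => (mulL m).le_opNorm₂ (kernelK q x) (f x))

theorem exists_enorm_teodorescu_le_rpow (hm : 1 ≤ m) (hΩ : Bornology.IsBounded Ω)
    (hp : max (m : ℝ) 2 < p) :
    ∃ C ≠ ∞, ∀ f : Para m → Cl m, AEStronglyMeasurable f (volume.restrict Ω) → ∀ q : Para m,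
      ‖teodorescu Ω f q‖ₑ ≤ C * eLpNorm f (ENNReal.ofReal p) (volume.restrict Ω) *
        ‖vecNorm q‖ₑ ^ (-((m - 1) / p)) := by
  have hpP := Real.HolderConjugate.conjExponent
    (one_lt_two.trans ((le_max_right _ _).trans_lt hp))
  obtain ⟨C, hC, hK⟩ := exists_eLpNorm_kernelK_le_rpow hm hΩ hpP hp
  refine ⟨‖1 / (2 * Real.pi)‖ₑ * ‖mulL m‖ₑ * C, by finiteness, fun f hf q => ?_⟩
  calc ‖teodorescu Ω f q‖ₑ
      ≤ ‖1 / (2 * Real.pi)‖ₑ * (‖mulL m‖ₑ * (C * ‖vecNorm q‖ₑ ^ (-((m - 1) / p))) *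
          eLpNorm f (ENNReal.ofReal p) (volume.restrict Ω)) := by
        refine (enorm_teodorescu_le hpP hf q).trans ?_
        gcongr
        exact hK q
    _ = _ := by ring

theorem exists_eLpNorm_teodorescu_le (hm : 1 ≤ m) (hΩ : Bornology.IsBounded Ω)
    (hp : max (m : ℝ) 2 < p) :
    ∃ C : ℝ≥0, ∀ f : Para m → Cl m, MemLp f (ENNReal.ofReal p) (volume.restrict Ω) →
      eLpNorm (teodorescu Ω f) (ENNReal.ofReal p) (volume.restrict Ω) ≤
        C * eLpNorm f (ENNReal.ofReal p) (volume.restrict Ω) := by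
  have hp₀ : 0 < p := two_pos.trans ((le_max_right _ _).trans_lt hp)
  obtain ⟨C, hC, hT⟩ := exists_enorm_teodorescu_le_rpow hm hΩ hp
  obtain ⟨R, hR⟩ := hΩ.subset_ball 0
  set J : ℝ≥0∞ := ∫⁻ q in Ω, ‖vecNorm q‖ₑ ^ (-(m - 1 : ℝ))
  have hJ : J ≠ ∞ := ((lintegral_mono_set hR).trans_lt
    (setLIntegral_ball_vecNorm_rpow_neg_lt_top hm (sub_one_lt (m : ℝ)) R)).ne
  refine ⟨(C * J ^ (1 / p)).toNNReal, fun f hf => ?_⟩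
  set N := eLpNorm f (ENNReal.ofReal p) (volume.restrict Ω)
  have hN : N ≠ ∞ := hf.eLpNorm_ne_top
  rw [ENNReal.coe_toNNReal (by finiteness), eLpNorm_ofReal_eq_lintegral hp₀]
  calc (∫⁻ q in Ω, ‖teodorescu Ω f q‖ₑ ^ p) ^ (1 / p)
      ≤ (∫⁻ q in Ω, (C * N) ^ p * ‖vecNorm q‖ₑ ^ (-(m - 1 : ℝ))) ^ (1 / p) := by
        gcongr with q
        refine (ENNReal.rpow_le_rpow (hT f hf.1 q) hp₀.le).trans_eq ?_
        rw [ENNReal.mul_rpow_of_nonneg _ _ hp₀.le, ← ENNReal.rpow_mul, neg_mul,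
          div_mul_cancel₀ _ hp₀.ne']
    _ = C * J ^ (1 / p) * N := by
        rw [lintegral_const_mul' _ _ (by finiteness),
          ENNReal.mul_rpow_of_nonneg _ _ (by positivity), one_div, ENNReal.rpow_rpow_inv hp₀.ne']
        ring

end Boundedness

section OffClosure

variable {m : ℕ} {q x : Para m} {Ω : Set (Para m)}

theorem companion_ne_zero (h : halfPlane q ≠ halfPlane x) : companion q x ≠ 0 := by
  rw [← norm_ne_zero_iff, norm_companion]
  refine mul_ne_zero (norm_ne_zero_iff.2 (sub_ne_zero.2 h)) (norm_ne_zero_iff.2 ?_)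
  refine sub_ne_zero.2 fun hconj => h ?_
  have hre : q 0 = x 0 := congrArg Complex.re hconj
  have him : -vecNorm q = vecNorm x := congrArg Complex.im hconj
  have hq := vecNorm_nonneg q
  have hx := vecNorm_nonneg x
  exact Complex.ext hre (show vecNorm q = vecNorm x by linarith)

theorem contDiffAt_sliceCauchyKernel (h : companion q x ≠ 0) :
    ContDiffAt ℝ 1 (Function.uncurry (sliceCauchyKernel (m := m))) (q, x) := by
  have hcompanion : ContDiffAt ℝ 1 (fun z : Para m × Para m => companion z.1 z.2) (q, x) :=
    contDiff_companion.contDiffAt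
  have hnum : ContDiffAt ℝ 1 (fun z : Para m × Para m =>
      mulL m (conjClL m (companion z.1 z.2)) (toClL m z.1 - conjClL m z.2)) (q, x) := by
    fun_prop
  have hinv := (hcompanion.norm_sq ℝ).inv (pow_ne_zero 2 (norm_ne_zero_iff.2 h))
  refine (hinv.smul hnum).neg.congr_of_eventuallyEq (.of_forall fun z => ?_)
  refine (sliceCauchyKernel_eq z.1 z.2).trans ?_
  simp only [mulL_apply, conjClL_apply, toClL_apply]
  rfl

theorem toCl_companion_mul_sliceCauchyKernel (h : companion q x ≠ 0) :
    toCl (companion q x) * sliceCauchyKernel q x = -(toCl q - conjCl x) := by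
  rw [sliceCauchyKernel_eq, mul_neg, mul_smul_comm, ← mul_assoc, toCl_mul_conjCl, smul_mul_assoc,
    one_mul, inv_smul_smul₀ (pow_ne_zero 2 (norm_ne_zero_iff.2 h))]

theorem toCl_companion_mul_fderiv_sliceCauchyKernel (h : companion q x ≠ 0) (v : Para m) :
    toCl (companion q x) * fderiv ℝ (sliceCauchyKernel · x) q v = -toCl v -
      (toCl q * toCl v + toCl v * toCl q - (2 * x 0) • toCl v) * sliceCauchyKernel q x := by
  have hne : ∀ᶠ q' in nhds q, companion q' x ≠ 0 := by
    have hcont : Continuous fun q' => companion q' x := by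
      unfold companion
      fun_prop
    exact hcont.continuousAt.eventually_ne h
  have hS : HasFDerivAt (sliceCauchyKernel · x) (fderiv ℝ (sliceCauchyKernel · x) q) q :=
    (hasFDerivAt_left_of_differentiableAt_uncurry
      ((contDiffAt_sliceCauchyKernel h).differentiableAt one_ne_zero)).differentiableAt.hasFDerivAt
  have htoCl : HasFDerivAt toCl (toClL m) q :=
    (toClL m).hasFDerivAt.congr_of_eventuallyEq (.of_forall fun y => (toClL_apply y).symm)
  have hden := (((mulL m).hasFDerivAt_of_bilinear htoCl htoCl).sub
    (htoCl.const_smul (2 * x 0))).add_const (algebraMap ℝ (Cl m) (‖x‖ ^ 2))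
    |>.congr_of_eventuallyEq (f₁ := fun q' => toCl (companion q' x))
      (.of_forall fun q' => (toCl_companion q' x).trans (by rw [sq]; rfl))
  have hprod := ((mulL m).hasFDerivAt_of_bilinear hden hS).unique
    ((htoCl.sub_const (conjCl x)).neg.congr_of_eventuallyEq
      (hne.mono fun q' hq' => toCl_companion_mul_sliceCauchyKernel hq'))
  have happly := DFunLike.congr_fun hprod v
  rw [eq_sub_iff_add_eq, ← toClL_apply v]
  exact happly

/-- The vector part `x̲ = (0, x₁, …, x_m)` of a paravector, as a direction of differentiation. -/
noncomputable def vecPart (x : Para m) : Para m :=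
  ∑ j : Fin m, x j.succ • EuclideanSpace.single j.succ 1

theorem toCl_single_succ (j : Fin m) :
    toCl (EuclideanSpace.single j.succ 1 : Para m) = e j := by
  simp [toCl, vec]

theorem toCl_vecPart (x : Para m) : toCl (vecPart x) = vec x := by
  rw [← toClL_apply, vecPart, map_sum, vec]
  simp only [map_smul, toClL_apply, toCl_single_succ]

theorem commute_vec_toCl (q : Para m) : Commute (vec q) (toCl q) :=
  (Algebra.commute_algebraMap_right _ _).add_right (Commute.refl _)

theorem commute_vec_toCl_companion (q x : Para m) :
    Commute (vec q) (toCl (companion q x)) := by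
  rw [toCl_companion]
  exact ((((commute_vec_toCl q).pow_right 2).sub_right
    ((commute_vec_toCl q).smul_right _)).add_right (Algebra.commute_algebraMap_right _ _))

theorem fderiv_sliceCauchyKernel_vecPart (h : companion q x ≠ 0) :
    fderiv ℝ (sliceCauchyKernel · x) q (vecPart q) =
      vec q * fderiv ℝ (sliceCauchyKernel · x) q (EuclideanSpace.single 0 1) := by
  refine (isUnit_toCl h).mul_left_cancel ?_
  rw [← mul_assoc, ← (commute_vec_toCl_companion q x).eq, mul_assoc,
    toCl_companion_mul_fderiv_sliceCauchyKernel h, toCl_companion_mul_fderiv_sliceCauchyKernel h,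
    toCl_vecPart, toCl_single_zero, ← (commute_vec_toCl q).eq]
  simp only [mul_sub, mul_add, sub_mul, add_mul, mul_neg, mul_one, one_mul, mul_smul_comm,
    smul_mul_assoc, mul_assoc]

theorem sliceCR_of_hasFDerivAt {g : Para m → Cl m} {L : Para m →L[ℝ] Cl m}
    (hg : HasFDerivAt g L q) :
    sliceCR g q = L (EuclideanSpace.single 0 1) +
      ((vecNorm q ^ 2)⁻¹ • vec q) * L (vecPart q) := by
  rw [sliceCR, vecPart, map_sum]
  simp only [map_smul, (hg.hasLineDerivAt _).lineDeriv]

theorem sliceCR_eq_zero_of_hasFDerivAt {g : Para m → Cl m} {L : Para m →L[ℝ] Cl m}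
    (hg : HasFDerivAt g L q) (hq : q ∉ realAxis m)
    (hL : L (vecPart q) = vec q * L (EuclideanSpace.single 0 1)) : sliceCR g q = 0 := by
  have hvec : vecNorm q ^ 2 ≠ 0 := pow_ne_zero 2 (vecNorm_eq_zero_iff.not.2 hq)
  rw [sliceCR_of_hasFDerivAt hg, hL, smul_mul_assoc, ← mul_assoc, vec_mul_vec_self, smul_mul_assoc,
    one_mul, neg_smul, smul_neg, inv_smul_smul₀ hvec, add_neg_cancel]

end OffClosure

section TeodorescuOffClosure

variable {m : ℕ} {Ω : Set (Para m)} {p : ℝ} {f : Para m → Cl m} {q : Para m}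

theorem contDiffAt_sliceCauchyKernel_of_mem_closure
    (hq : halfPlane q ∉ closure (halfPlane '' Ω)) {x : Para m} (hx : x ∈ closure Ω) :
    ContDiffAt ℝ 1 (Function.uncurry (sliceCauchyKernel (m := m))) (q, x) :=
  contDiffAt_sliceCauchyKernel <| companion_ne_zero fun hqx =>
    hq (hqx ▸ map_mem_closure continuous_halfPlane hx (Set.mapsTo_image _ _))

theorem integrableOn_kernelWeight_smul (hm : 1 ≤ m) (hΩ : Bornology.IsBounded Ω)
    (hmp : (m : ℝ) < p) (hf : MemLp f (ENNReal.ofReal p) (volume.restrict Ω)) :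
    IntegrableOn (fun x => kernelWeight x • f x) Ω := by
  have hm₁ : (1 : ℝ) ≤ m := mod_cast hm
  have hpP := Real.HolderConjugate.conjExponent (hm₁.trans_lt hmp)
  have := hpP.symm.ennrealOfReal
  exact memLp_one_iff_integrable.1 (hf.smul
    (memLp_kernelWeight hm hΩ hpP.symm.pos (sub_one_mul_lt_of_lt hpP hmp)))

theorem integrableOn_precompL_fderiv_sliceCauchyKernel (hΩ : Bornology.IsBounded Ω)
    (hq : halfPlane q ∉ closure (halfPlane '' Ω)) {g : Para m → Cl m} (hg : IntegrableOn g Ω) :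
    IntegrableOn (fun x =>
      (mulL m).precompL (Para m) (fderiv ℝ (sliceCauchyKernel · x) q) (g x)) Ω :=
  integrable_precompL_fderiv_left (mulL m) hΩ.isCompact_closure (ae_mem_closure Ω)
    (fun _ hx => contDiffAt_sliceCauchyKernel_of_mem_closure hq hx) hg

theorem hasFDerivAt_integral_sliceCauchyKernel_mul (hΩ : Bornology.IsBounded Ω)
    (hq : halfPlane q ∉ closure (halfPlane '' Ω)) {g : Para m → Cl m} (hg : IntegrableOn g Ω) :
    HasFDerivAt (fun q' => ∫ x in Ω, sliceCauchyKernel q' x * g x)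
      (∫ x in Ω, (mulL m).precompL (Para m) (fderiv ℝ (sliceCauchyKernel · x) q) (g x)) q :=
  hasFDerivAt_integral_bilin_of_contDiffAt (mulL m) hΩ.isCompact_closure (ae_mem_closure Ω)
    (fun _ hx => contDiffAt_sliceCauchyKernel_of_mem_closure hq hx) hg

theorem integral_precompL_fderiv_sliceCauchyKernel_vecPart (hΩ : Bornology.IsBounded Ω)
    (hq : halfPlane q ∉ closure (halfPlane '' Ω)) {g : Para m → Cl m} (hg : IntegrableOn g Ω) :
    (∫ x in Ω, (mulL m).precompL (Para m) (fderiv ℝ (sliceCauchyKernel · x) q) (g x))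
        (vecPart q) =
      vec q * (∫ x in Ω, (mulL m).precompL (Para m) (fderiv ℝ (sliceCauchyKernel · x) q) (g x))
        (EuclideanSpace.single 0 1) := by
  have hint := integrableOn_precompL_fderiv_sliceCauchyKernel hΩ hq hg
  rw [ContinuousLinearMap.integral_apply hint, ContinuousLinearMap.integral_apply hint,
    ← mulL_apply, ← ContinuousLinearMap.integral_comp_comm _ (hint.apply_continuousLinearMap _)]
  refine integral_congr_ae ((ae_halfPlane_mem_closure Ω).mono fun x hx => ?_)
  have hne : halfPlane q ≠ halfPlane x := fun hqx => hq (hqx ▸ hx)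
  have hderiv := fderiv_sliceCauchyKernel_vecPart (companion_ne_zero hne)
  simp only [ContinuousLinearMap.precompL_apply, hderiv, mulL_apply, mul_assoc]

theorem teodorescu_eq_integral_sliceCauchyKernel (Ω : Set (Para m)) (f : Para m → Cl m) :
    teodorescu Ω f = fun q => (-(1 / (2 * Real.pi))) •
      ∫ x in Ω, sliceCauchyKernel q x * (kernelWeight x • f x) := by
  funext q
  rw [teodorescu, neg_smul]
  congr 3 with x
  rw [mul_smul_comm, ← smul_mul_assoc]
  rfl

theorem teodorescu_sliceMonogenic (hm : 1 ≤ m) (hΩ : Bornology.IsBounded Ω)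
    (hmp : (m : ℝ) < p) (hf : MemLp f (ENNReal.ofReal p) (volume.restrict Ω))
    (hq : halfPlane q ∉ closure (halfPlane '' Ω)) :
    DifferentiableAt ℝ (teodorescu Ω f) q ∧
      (q ∉ realAxis m → sliceCR (teodorescu Ω f) q = 0) := by
  have hg := integrableOn_kernelWeight_smul hm hΩ hmp hf
  have hT := (hasFDerivAt_integral_sliceCauchyKernel_mul hΩ hq hg).const_smul
    (-(1 / (2 * Real.pi)))
  rw [teodorescu_eq_integral_sliceCauchyKernel]
  refine ⟨hT.differentiableAt, fun hq_real => sliceCR_eq_zero_of_hasFDerivAt hT hq_real ?_⟩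
  rw [smul_apply, smul_apply, integral_precompL_fderiv_sliceCauchyKernel_vecPart hΩ hq hg,
    mul_smul_comm]

end TeodorescuOffClosure

section AxialSymmetry

variable {m : ℕ}

theorem vecNorm_slicePoint {J : EuclideanSpace ℝ (Fin m)} (hJ : ‖J‖ = 1) (z : ℂ) :
    vecNorm (slicePoint J z) = |z.im| := by
  have htail : (WithLp.toLp 2 fun j : Fin m => slicePoint J z j.succ) = z.im • J := by
    ext j
    simp [slicePoint, mul_comm]
  rw [vecNorm_eq_norm_tail, htail, norm_smul, hJ, mul_one, Real.norm_eq_abs]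

theorem slicePoint_neg_conj (J : EuclideanSpace ℝ (Fin m)) (z : ℂ) :
    slicePoint (-J) (starRingEnd ℂ z) = slicePoint J z := by
  simp [slicePoint]

theorem halfPlane_slicePoint {J : EuclideanSpace ℝ (Fin m)} (hJ : ‖J‖ = 1) (z : ℂ) :
    halfPlane (slicePoint J z) = z ∨ halfPlane (slicePoint J z) = starRingEnd ℂ z := by
  have hre : (halfPlane (slicePoint J z)).re = z.re := rfl
  have him : (halfPlane (slicePoint J z)).im = |z.im| := vecNorm_slicePoint hJ z
  exact (abs_choice z.im).imp (fun h => Complex.ext hre (him.trans h))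
    fun h => Complex.ext hre (him.trans h)

theorem slicePoint_halfPlane_mem_axialSet {D : Set ℂ} {x : Para m} (hx : x ∈ axialSet m D)
    {J : EuclideanSpace ℝ (Fin m)} (hJ : ‖J‖ = 1) : slicePoint J (halfPlane x) ∈ axialSet m D := by
  simp only [axialSet, Set.mem_iUnion, Set.mem_image, mem_sphere_zero_iff_norm] at hx ⊢
  obtain ⟨I, hI, z, hz, rfl⟩ := hx
  rcases halfPlane_slicePoint hI z with h | h <;> rw [h]
  · exact ⟨J, hJ, z, hz, rfl⟩
  · exact ⟨-J, (norm_neg J).trans hJ, z, hz, by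
      rw [← slicePoint_neg_conj (-J), neg_neg]⟩

theorem exists_slicePoint_halfPlane_eq {q : Para m} (hq : q ∉ realAxis m) :
    ∃ J : EuclideanSpace ℝ (Fin m), ‖J‖ = 1 ∧ slicePoint J (halfPlane q) = q := by
  have hvec : vecNorm q ≠ 0 := vecNorm_eq_zero_iff.not.2 hq
  refine ⟨(vecNorm q)⁻¹ • WithLp.toLp 2 fun j => q j.succ, ?_, ?_⟩
  · rw [norm_smul, ← vecNorm_eq_norm_tail, norm_inv, Real.norm_of_nonneg (vecNorm_nonneg q),
      inv_mul_cancel₀ hvec]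
  · ext i
    refine Fin.cases rfl (fun j => ?_) i
    change (vecNorm q)⁻¹ * q j.succ * vecNorm q = q j.succ
    rw [mul_right_comm, inv_mul_cancel₀ hvec, one_mul]

theorem continuous_slicePoint (J : EuclideanSpace ℝ (Fin m)) : Continuous (slicePoint J) := by
  refine (PiLp.continuous_toLp 2 _).comp (continuous_pi (Fin.cases ?_ fun j => ?_))
  · exact Complex.continuous_re
  · exact continuous_const.mul Complex.continuous_im

theorem IsAxiallySymmetric.mem_closure {Ω : Set (Para m)} (hΩ : IsAxiallySymmetric Ω) {q : Para m}
    (hq : q ∉ realAxis m) (h : halfPlane q ∈ closure (halfPlane '' Ω)) : q ∈ closure Ω := by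
  obtain ⟨-, D, -, rfl⟩ := hΩ
  obtain ⟨J, hJ, hJq⟩ := exists_slicePoint_halfPlane_eq hq
  have hmaps : Set.MapsTo (slicePoint J) (halfPlane '' axialSet m D) (axialSet m D) :=
    Set.mapsTo_image_iff.2 fun x hx => slicePoint_halfPlane_mem_axialSet hx hJ
  exact hJq ▸ map_mem_closure (continuous_slicePoint J) h hmaps

end AxialSymmetry

end SliceClifford

theorem mainTheorem3_general (m : ℕ) (hm : 1 ≤ m)
    (Ω : Set (SliceClifford.Para m))
    (hΩb : Bornology.IsBounded Ω)
    (p : ℝ) (hp : max (m : ℝ) 2 < p) :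
    (∀ f : SliceClifford.Para m → SliceClifford.Cl m,
      MemLp f (ENNReal.ofReal p) (volume.restrict Ω) →
        (∀ q : SliceClifford.Para m,
          (q ∉ closure Ω ∩ SliceClifford.realAxis m ∨ (m : ℝ) + 1 < p) →
            IntegrableOn (fun x => SliceClifford.kernelK q x * f x) Ω volume) ∧
        (∀ q : SliceClifford.Para m,
          SliceClifford.halfPlane q ∉ closure (SliceClifford.halfPlane '' Ω) →
            DifferentiableAt ℝ (SliceClifford.teodorescu Ω f) q ∧
              (q ∉ SliceClifford.realAxis m →
                SliceClifford.sliceCR (SliceClifford.teodorescu Ω f) q = 0))) ∧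
    (∃ C : ℝ≥0, ∀ f : SliceClifford.Para m → SliceClifford.Cl m,
      MemLp f (ENNReal.ofReal p) (volume.restrict Ω) →
        MemLp (SliceClifford.teodorescu Ω f) (ENNReal.ofReal p) (volume.restrict Ω) ∧
        eLpNorm (SliceClifford.teodorescu Ω f) (ENNReal.ofReal p) (volume.restrict Ω) ≤
          C * eLpNorm f (ENNReal.ofReal p) (volume.restrict Ω)) := by
  obtain ⟨hmp, hp₂⟩ := max_lt_iff.1 hp
  have hpP := Real.HolderConjugate.conjExponent (one_lt_two.trans hp₂)
  refine ⟨fun f hf => ⟨fun q hq => ?_, fun q hq => ?_⟩, ?_⟩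
  · exact SliceClifford.integrableOn_kernelK_mul hpP hf
      (SliceClifford.memLp_kernelK hm hΩb hpP hp hq)
  · exact SliceClifford.teodorescu_sliceMonogenic hm hΩb hmp hf hq
  · obtain ⟨C, hC⟩ := SliceClifford.exists_eLpNorm_teodorescu_le hm hΩb hp
    exact ⟨C, fun f hf => ⟨⟨SliceClifford.aestronglyMeasurable_teodorescu hf.1,
      (hC f hf).trans_lt (ENNReal.mul_lt_top ENNReal.coe_lt_top hf.2)⟩, hC f hf⟩⟩

theorem mainTheorem3 (m : ℕ) (hm : 1 ≤ m)
    (Ω : Set (SliceClifford.Para m))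
    (hΩ : SliceClifford.IsAxiallySymmetric Ω)
    (hΩb : Bornology.IsBounded Ω)
    (hΩr : Disjoint Ω (SliceClifford.realAxis m))
    (p : ℝ) (hp : max (m : ℝ) 2 < p) :
    (∀ f : SliceClifford.Para m → SliceClifford.Cl m,
      MemLp f (ENNReal.ofReal p) (volume.restrict Ω) →
        (∀ q : SliceClifford.Para m,
          (q ∉ frontier Ω ∩ SliceClifford.realAxis m ∨ (m : ℝ) + 1 < p) →
            IntegrableOn (fun x => SliceClifford.kernelK q x * f x) Ω volume) ∧
        (∀ q : SliceClifford.Para m, q ∉ closure Ω → q ∉ SliceClifford.realAxis m →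
          DifferentiableAt ℝ (SliceClifford.teodorescu Ω f) q ∧
            SliceClifford.sliceCR (SliceClifford.teodorescu Ω f) q = 0)) ∧
    (∃ C : ℝ≥0, ∀ f : SliceClifford.Para m → SliceClifford.Cl m,
      MemLp f (ENNReal.ofReal p) (volume.restrict Ω) →
        MemLp (SliceClifford.teodorescu Ω f) (ENNReal.ofReal p) (volume.restrict Ω) ∧
        eLpNorm (SliceClifford.teodorescu Ω f) (ENNReal.ofReal p) (volume.restrict Ω) ≤
          C * eLpNorm f (ENNReal.ofReal p) (volume.restrict Ω)) := by
  obtain ⟨hf, hbound⟩ := mainTheorem3_general m hm Ω hΩb p hp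
  have hfrontier :
      frontier Ω ∩ SliceClifford.realAxis m = closure Ω ∩ SliceClifford.realAxis m := by
    rw [hΩ.1.frontier_eq, Set.sdiff_inter_right_comm]
    exact (hΩr.symm.mono_left Set.inter_subset_right).sdiff_eq_left
  exact ⟨fun f hfp => ⟨fun q hq => (hf f hfp).1 q (hfrontier.symm ▸ hq), fun q hq hreal =>
    have h := (hf f hfp).2 q fun hcl => hq (hΩ.mem_closure hreal hcl)
    ⟨h.1, h.2 hreal⟩⟩, hbound⟩
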